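/- Let $\mathcal G$ be a simple graph without full (induced) $4$-cycles. The triangle-pentagon complex $X$ of $\mathcal G$ is the two-dimensional cell complex with $1$-skeleton $X^{(1)}=\mathcal G$ whose $2$-cells are solid triangles and pentagons, one for each triangle of $\mathcal G$ and one for each pentagon without diagonals (induced $5$-cycle) of $\mathcal G$. It carries the intrinsic piecewise Euclidean metric in which edges have length $1$ and the $2$-cells are regular triangles and regular pentagons of side length $1$. Its subdivision $X^\star$ is the simplicial complex obtained by adding the center of every pentagon as a new vertex and replacing the pentagon by the five triangles spanned by its center and its edges. In a simplicial complex, write $u\sim v$ if $u$ and $v$ span a simplex. A complex is flag if every nonempty finite set of vertices that are pairwise joined by edges spans a simplex. A full cycle is a cycle that is full as a subcomplex (any simplex spanned by its vertices lies in it). The complex is locally $5$-large if the link of each simplex is flag and has no full cycle of length less than $5$. A full $k$-wheel $(v_0;v_1,\dots,v_k)$ is the cone with apex $v_0$ over a full cycle $(v_1,\dots,v_k)$, such that this cone is a full subcomplex. The complex is $7$-located if it is flag and the following holds for every union $W=W_1\cup W_2$ of two full wheels $W_1=(w_l;v_1,\dots,v_k)$ and $W_2=(v_2;w_1,\dots,w_l)$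 with $v_3=w_{l-1}$ and with $v_1=w_1$ or $v_1\sim w_1$: if the boundary length of $W$, which is $k+l-4$ when $v_1=w_1$ and $k+l-3$ when $v_1\ne w_1$, is at most $7$, then $W$ is contained in the link of some vertex. A simplicial action of a group is geometric if the stabilizers of all simplices are finite and the quotient of the geometric realization is compact. Suppose that $X$ is a CAT(0) space, and let a group $G$ act geometrically on the $1$-skeleton $X^{(1)}$, viewed as a one-dimensional simplicial complex. Then $G$ is $7$-located and locally $5$-large, in the following sense. The action extends to a geometric simplicial action of $G$ on $X^\star$, which agrees with the given action on the vertices of $X$ and sends the center of a pentagon $P$ to the center of the pentagon $gP$ for each $g\in G$; and $X^\star$ is $7$-located and locally $5$-large. -/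

import Mathlib

open scoped NNReal ENNReal

noncomputable section

namespace TrianglePentagon

/-! ### Simplicial complexes

Simplicial complexes are Mathlib's `PreAbstractSimplicialComplex V`: a family of nonempty finite
subsets of `V`, the simplices, closed under passing to nonempty subsets. -/

section Simplicial

variable {V : Type*}

/-- The simplicial complex whose simplices are the nonempty finite sets contained in one of the
sets of the family `A`. -/
def generatedComplex (A : Set (Set V)) : PreAbstractSimplicialComplex V where
  faces := {s | s.Nonempty ∧ ∃ B ∈ A, (s : Set V) ⊆ B}
  isRelLowerSet_faces := by
    rintro s ⟨hs, B, hB, hsB⟩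
    exact ⟨hs, fun t hts ht => ⟨ht, B, hB, fun x hx => hsB (hts hx)⟩⟩

/-- `u ∼ v`: the vertices `u` and `v` span a simplex (`u = v` is allowed). -/
def Joined (K : PreAbstractSimplicialComplex V) (u v : V) : Prop :=
  ∃ e ∈ K.faces, (e : Set V) = {u, v}

/-- Any nonempty finite set of pairwise joined vertices spans a simplex. -/
def IsFlag (K : PreAbstractSimplicialComplex V) : Prop :=
  ∀ s : Finset V, s.Nonempty → (∀ u ∈ s, ∀ v ∈ s, Joined K u v) → s ∈ K.faces

/-- The link of `σ`: the simplices that are disjoint from `σ` and together with `σ` span a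
simplex. -/
def link (K : PreAbstractSimplicialComplex V) (σ : Finset V) : PreAbstractSimplicialComplex V where
  faces := {τ | τ.Nonempty ∧ Disjoint (τ : Set V) (σ : Set V) ∧
    ∃ υ ∈ K.faces, (υ : Set V) = (τ : Set V) ∪ (σ : Set V)}
  isRelLowerSet_faces := by
    classical
    rintro τ ⟨hτ, hd, υ, hυ, hυe⟩
    refine ⟨hτ, fun t hts ht => ⟨ht, hd.mono_left (by exact_mod_cast hts), t ∪ σ, ?_, by simp⟩⟩
    refine (K.isRelLowerSet_faces hυ).2 ?_ (ht.mono Finset.subset_union_left)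
    intro x hx
    have hx' : x ∈ (υ : Set V) := by
      rw [hυe]
      rcases Finset.mem_union.1 hx with h | h
      · exact Or.inl (hts h)
      · exact Or.inr h
    exact hx'

/-- The closed polygon `c` with vertices `c i`, `i ∈ ℤ/n`, is a full cycle of length `n`: the
simplices spanned by its vertices are exactly its vertices and its edges `{c i, c (i + 1)}`. -/
def IsFullCycle (K : PreAbstractSimplicialComplex V) (n : ℕ) (c : ZMod n → V) : Prop :=
  3 ≤ n ∧ Function.Injective c ∧
    ∀ s : Finset V, (s : Set V) ⊆ Set.range c →
      (s ∈ K.faces ↔ s.Nonempty ∧ ∃ i, (s : Set V) ⊆ {c i, c (i + 1)})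

/-- `k`-large: flag, without full cycles of length less than `k`. -/
def IsLarge (k : ℕ) (K : PreAbstractSimplicialComplex V) : Prop :=
  IsFlag K ∧ ∀ j < k, ∀ c : ZMod j → V, ¬ IsFullCycle K j c

/-- Locally `k`-large: the links of all simplices are `k`-large. -/
def IsLocallyLarge (k : ℕ) (K : PreAbstractSimplicialComplex V) : Prop :=
  ∀ σ ∈ K.faces, IsLarge k (link K σ)

/-- `(v₀; v)` is a wheel with centre `v₀` and with rim the full cycle `v`, and the wheel (the cone
over its rim) is a full subcomplex of `K`. -/
def IsFullWheel (K : PreAbstractSimplicialComplex V) (n : ℕ) (v₀ : V) (v : ZMod n → V) : Prop :=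
  IsFullCycle K n v ∧ v₀ ∉ Set.range v ∧
    ∀ s : Finset V, (s : Set V) ⊆ insert v₀ (Set.range v) →
      (s ∈ K.faces ↔ s.Nonempty ∧ ∃ i, (s : Set V) ⊆ {v₀, v i, v (i + 1)})

/-- The two full wheels `W₁ = (w_l; v₁, …, v_k)` and `W₂ = (v₂; w₁, …, w_l)` with
`v₃ = w_{l-1}` whose union is a dwheel. The indices are read modulo `k` and modulo `l`, so that
`w_l` is `w 0` and `w_{l-1}` is `w (-1)`. -/
def IsWheelPair (K : PreAbstractSimplicialComplex V) (k l : ℕ)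
    (v : ZMod k → V) (w : ZMod l → V) : Prop :=
  IsFullWheel K k (w 0) v ∧ IsFullWheel K l (v 2) w ∧ v 3 = w (-1)

/-- The boundary of a dwheel has length at most `m`. A dwheel with `v₁ = w₁` is planar, with
boundary length `k + l - 4`; a dwheel with `v₁ ≠ w₁` and `v₁ ∼ w₁` is nonplanar, with boundary
length `k + l - 3`. -/
def IsDwheelOfBoundaryLE (K : PreAbstractSimplicialComplex V) (m k l : ℕ)
    (v : ZMod k → V) (w : ZMod l → V) : Prop :=
  IsWheelPair K k l v w ∧
    ((v 1 = w 1 ∧ k + l ≤ m + 4) ∨ (v 1 ≠ w 1 ∧ Joined K (v 1) (w 1) ∧ k + l ≤ m + 3))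

/-- `m`-located: flag, and every dwheel made of two full wheels and with boundary of length at most
`m` is contained in the link of a vertex. -/
def IsLocated (m : ℕ) (K : PreAbstractSimplicialComplex V) : Prop :=
  IsFlag K ∧
    ∀ (k l : ℕ) (v : ZMod k → V) (w : ZMod l → V), IsDwheelOfBoundaryLE K m k l v w →
      ∃ x : V, {x} ∈ K.faces ∧ ∀ s ∈ K.faces,
        ((s : Set V) ⊆ insert (w 0) (Set.range v) ∨ (s : Set V) ⊆ insert (v 2) (Set.range w)) →
          s ∈ (link K {x}).faces

/-! ### Geometric realization and geometric actions -/

/-- The points of the geometric realization, in barycentric coordinates. -/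
def Realization (K : PreAbstractSimplicialComplex V) : Type _ :=
  {x : V →₀ ℝ // x.support ∈ K.faces ∧ (∀ v, 0 ≤ x v) ∧ (x.sum fun _ a => a) = 1}

/-- The closed simplex `s` in the geometric realization. -/
def ClosedSimplex (K : PreAbstractSimplicialComplex V) (s : Finset V) : Type _ :=
  {x : Realization K // x.1.support ⊆ s}

/-- A closed simplex has the topology of its barycentric coordinates. -/
instance (K : PreAbstractSimplicialComplex V) (s : Finset V) :
    TopologicalSpace (ClosedSimplex K s) :=
  TopologicalSpace.induced (fun x v => x.1.1 v) (inferInstanceAs (TopologicalSpace (V → ℝ)))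

/-- The weak topology: a set is open iff its trace on each closed simplex is open. -/
instance (K : PreAbstractSimplicialComplex V) : TopologicalSpace (Realization K) :=
  ⨆ s ∈ K.faces, TopologicalSpace.coinduced (fun x : ClosedSimplex K s => x.1) inferInstance

/-- The group of simplicial automorphisms. -/
def Aut (K : PreAbstractSimplicialComplex V) : Subgroup (Equiv.Perm V) where
  carrier := {g | ∀ s : Finset V, s.map g.toEmbedding ∈ K.faces ↔ s ∈ K.faces}
  mul_mem' := by
    intro g h hg hh s
    rw [← hh s, ← hg (s.map h.toEmbedding), Finset.map_map]
    rfl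
  one_mem' := by
    intro s
    have h : s.map (1 : Equiv.Perm V).toEmbedding = s := Finset.map_refl
    rw [h]
  inv_mem' := by
    intro g hg s
    rw [← hg (s.map (g⁻¹).toEmbedding), Finset.map_map]
    have h : s.map ((g⁻¹ : Equiv.Perm V).toEmbedding.trans g.toEmbedding) = s := by ext; simp
    rw [h]

variable {Γ : Type*} [Group Γ]

/-- Two points of the realization are in the same orbit of the action `ρ`. -/
def SameOrbit (K : PreAbstractSimplicialComplex V) (ρ : Γ →* Aut K) (x y : Realization K) : Prop :=
  ∃ γ : Γ, ∀ v : V, y.1 ((ρ γ : Equiv.Perm V) v) = x.1 v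

/-- A simplicial action is geometric if the stabilizers of all simplices are finite and the quotient
of the geometric realization is compact. -/
def IsGeometricAction (K : PreAbstractSimplicialComplex V) (ρ : Γ →* Aut K) : Prop :=
  (∀ s ∈ K.faces, {γ : Γ | s.map (ρ γ : Equiv.Perm V).toEmbedding = s}.Finite) ∧
    CompactSpace (Quot (SameOrbit K ρ))

end Simplicial

/-! ### CAT(0) spaces -/

section CAT0

variable {X : Type*} [PseudoEMetricSpace X]

/-- `c`, restricted to `[0, a]`, is a geodesic from `p` to `q`. -/
def IsGeodesic (c : ℝ → X) (a : ℝ) (p q : X) : Prop :=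
  0 ≤ a ∧ c 0 = p ∧ c a = q ∧
    ∀ s ∈ Set.Icc 0 a, ∀ t ∈ Set.Icc 0 a, edist (c s) (c t) = ENNReal.ofReal |s - t|

variable (X) in
/-- A CAT(0) space: a geodesic space in which the points `x ∈ [p, q]` and `y ∈ [p, r]` of a geodesic
triangle are at most as far from each other as the comparison points in a Euclidean comparison
triangle. (The vertex `p` is an arbitrary vertex of the triangle, so this treats all pairs of points
on two different sides; for points on the same side there is nothing to compare.) -/
def IsCAT0 : Prop :=
  (∀ p q : X, ∃ (c : ℝ → X) (a : ℝ), IsGeodesic c a p q) ∧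
    ∀ (p q r : X) (c₁ c₂ : ℝ → X) (a b : ℝ), IsGeodesic c₁ a p q → IsGeodesic c₂ b p r →
      ∀ p' q' r' : EuclideanSpace ℝ (Fin 2),
        edist p' q' = edist p q → edist p' r' = edist p r → edist q' r' = edist q r →
          ∀ s ∈ Set.Icc (0 : ℝ) 1, ∀ t ∈ Set.Icc (0 : ℝ) 1,
            edist (c₁ (s * a)) (c₂ (t * b)) ≤
              edist (AffineMap.lineMap p' q' s : EuclideanSpace ℝ (Fin 2))
                (AffineMap.lineMap p' r' t : EuclideanSpace ℝ (Fin 2))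

end CAT0

/-! ### Triangle-pentagon complexes

The triangle-pentagon complex `X` of a graph `G` has `1`-skeleton `G`, and its `2`-cells are
the solid triangles and pentagons bounded by the triangles and by the pentagons without diagonals
of `G`. -/

section Complex

variable {V : Type*} (G : SimpleGraph V)

/-- The pentagons of `X`, given by their vertex sets: a pentagon has no diagonals, so that its
boundary is the subgraph of `G` induced by its five vertices. -/
def Pentagon : Type _ :=
  {P : Set V // ∃ φ : SimpleGraph.cycleGraph 5 ↪g G, Set.range φ = P}

/-- The graph `G`, which is the `1`-skeleton of `X`, as a `1`-dimensional simplicial complex. -/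
def oneSkeleton : PreAbstractSimplicialComplex V :=
  generatedComplex ({A | ∃ v, A = {v}} ∪ {A | ∃ u v, G.Adj u v ∧ A = {u, v}})

/-- The subdivision `X*` of `X`. Its vertices are the vertices `inl v` of `X` and the centres
`inr P` of the pentagons `P` of `X`. Its simplices are the vertices, the edges and the triangles
of `X`, and the triangles spanned by the centre of a pentagon and an edge of this pentagon, with
their faces. -/
def subdivision : PreAbstractSimplicialComplex (V ⊕ Pentagon G) :=
  generatedComplex
    ({A | ∃ v, A = {Sum.inl v}} ∪
      {A | ∃ u v, G.Adj u v ∧ A = {Sum.inl u, Sum.inl v}} ∪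
      {A | ∃ u v w, G.Adj u v ∧ G.Adj v w ∧ G.Adj u w ∧ A = {Sum.inl u, Sum.inl v, Sum.inl w}} ∪
      {A | ∃ (P : Pentagon G) (u v : V), u ∈ P.1 ∧ v ∈ P.1 ∧ G.Adj u v ∧
        A = {Sum.inr P, Sum.inl u, Sum.inl v}})

/-- The cells of `X` of positive dimension, with a labelling of their vertices in cyclic order:
the edges (`n = 2`), the triangles (`n = 3`) and the pentagons (`n = 5`). -/
structure Cell where
  n : ℕ
  hn : n = 2 ∨ n = 3 ∨ n = 5
  vertex : SimpleGraph.cycleGraph n ↪g G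

/-- The underlying space of `X`. A point is given by its barycentric coordinates with respect to the
subdivision `X*`, which has the same underlying space. -/
def Space : Type _ := Realization (subdivision G)

variable {G}

/-- The `k`-th vertex of the regular Euclidean `n`-gon in `ℂ` with centre `0` and side length `1`.
For `n = 2` this is a segment of length `1`. -/
def corner (n : ℕ) (k : Fin n) : ℂ :=
  (1 / (2 * Real.sin (Real.pi / n)) : ℝ) * Complex.exp (2 * Real.pi * Complex.I * (k : ℕ) / n)

/-- The point `x` lies in the closed cell `C`: its carrier is spanned by vertices of `C` and, if
`C` is a pentagon, the centre of `C`. -/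
def Cell.Contains (C : Cell G) (x : Space G) : Prop :=
  ∀ a ∈ x.1.support,
    (∃ i, a = Sum.inl (C.vertex i)) ∨ ∃ P : Pentagon G, P.1 = Set.range C.vertex ∧ a = Sum.inr P

/-- The identification of the closed cell `C` with the regular `n`-gon of side length `1`. It is
affine on each simplex of the subdivision, it respects the labelling of the vertices, and it sends
the centre of a pentagon to `0`. -/
def Cell.chart (C : Cell G) (x : Space G) : ℂ :=
  ∑ i, (x.1 (Sum.inl (C.vertex i)) : ℂ) * corner C.n i

/-- `IsString x y L`: there is a finite sequence of points from `x` to `y`, any two consecutive ones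
in a common closed cell, such that the Euclidean distances of consecutive points in these cells
add up to `L`. -/
inductive IsString : Space G → Space G → ℝ≥0 → Prop
  | nil (x : Space G) : IsString x x 0
  | cons (C : Cell G) {x y z : Space G} {L : ℝ≥0} (hx : C.Contains x) (hy : C.Contains y)
      (h : IsString y z L) : IsString x z (nndist (C.chart x) (C.chart y) + L)

theorem IsString.trans {x y z : Space G} {L M : ℝ≥0} (h : IsString x y L) (h' : IsString y z M) :
    IsString x z (L + M) := by
  induction h with
  | nil x => simpa using h'
  | cons C hx hy _ ih => rw [add_assoc]; exact IsString.cons C hx hy (ih h')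

theorem IsString.symm {x y : Space G} {L : ℝ≥0} (h : IsString x y L) : IsString y x L := by
  induction h with
  | nil x => exact IsString.nil x
  | cons C hx hy _ ih =>
    have := ih.trans (IsString.cons C hy hx (IsString.nil _))
    rwa [add_zero, nndist_comm, add_comm] at this

/-- The intrinsic metric of `X`, in which the edges have length `1` and the triangles and pentagons
are regular Euclidean polygons with side length `1`: the distance is the infimum of the lengths of
the strings between two points. -/
instance : PseudoEMetricSpace (Space G) where
  edist x y := ⨅ (L : ℝ≥0) (_ : IsString x y L), (L : ℝ≥0∞)
  edist_self x := le_antisymm (iInf₂_le_of_le 0 (IsString.nil x) (by simp)) bot_le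
  edist_comm x y := le_antisymm
    (le_iInf₂ fun L hL => iInf₂_le L hL.symm) (le_iInf₂ fun L hL => iInf₂_le L hL.symm)
  edist_triangle x y z := by
    simp_rw [ENNReal.iInf_add, ENNReal.add_iInf]
    refine le_iInf₂ fun L hL => le_iInf₂ fun M hM => ?_
    exact iInf₂_le_of_le (L + M) (hL.trans hM) (by simp)

end Complex

end TrianglePentagon

end

open scoped NNReal ENNReal

noncomputable section

namespace TrianglePentagon

/-! ### Geodesics in CAT(0) spaces -/

section CAT0

variable {X : Type*} [PseudoEMetricSpace X]

/-- `c` is isometric on `[A, B]`. -/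
def IsometricOn (c : ℝ → X) (A B : ℝ) : Prop :=
  ∀ s ∈ Set.Icc A B, ∀ t ∈ Set.Icc A B, edist (c s) (c t) = ENNReal.ofReal |s - t|

theorem IsCAT0.edist_eq_zero_of_isGeodesic (hX : IsCAT0 X) {p q : X} {c₁ c₂ : ℝ → X} {a : ℝ}
    (h₁ : IsGeodesic c₁ a p q) (h₂ : IsGeodesic c₂ a p q) {t : ℝ} (ht : t ∈ Set.Icc 0 a) :
    edist (c₁ t) (c₂ t) = 0 := by
  have ha : 0 ≤ a := h₁.1
  have hpq : edist p q = ENNReal.ofReal a := by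
    rw [← h₁.2.1, ← h₁.2.2.1, h₁.2.2.2 0 ⟨le_rfl, ha⟩ a ⟨ha, le_rfl⟩, zero_sub, abs_neg,
      abs_of_nonneg ha]
  rcases ha.eq_or_lt with rfl | ha'
  · obtain rfl : t = 0 := le_antisymm ht.2 ht.1
    rw [h₁.2.1, h₂.2.1, edist_self]
  have key := hX.2 p q q c₁ c₂ a a h₁ h₂ 0 (EuclideanSpace.single 0 a) (EuclideanSpace.single 0 a)
    (by rw [hpq, edist_dist, dist_zero_left]; simp [abs_of_nonneg ha])
    (by rw [hpq, edist_dist, dist_zero_left]; simp [abs_of_nonneg ha])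
    (by simp) (t / a) ⟨by have := ht.1; positivity, div_le_one_of_le₀ ht.2 ha⟩
    (t / a) ⟨by have := ht.1; positivity, div_le_one_of_le₀ ht.2 ha⟩
  rw [div_mul_cancel₀ _ ha'.ne', edist_self] at key
  exact le_antisymm key bot_le

theorem exists_comparison_triangle {a b D : ℝ} (ha : 0 < a) (hb : 0 < b) (h₁ : |a - b| ≤ D)
    (h₂ : D ≤ a + b) : ∃ q r : ℂ, ‖q‖ = a ∧ ‖r‖ = b ∧ dist q r = D ∧
      ∀ η : ℝ, dist ((η / a) • q) ((η / b) • r) ^ 2 * (a * b) = η ^ 2 * (D ^ 2 - (a - b) ^ 2) := by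
  have hD : 0 ≤ D := (abs_nonneg _).trans h₁
  set x : ℝ := (a ^ 2 + b ^ 2 - D ^ 2) / (2 * a * b) with hx
  have hab : 0 < 2 * a * b := by positivity
  have hxe : x * (2 * a * b) = a ^ 2 + b ^ 2 - D ^ 2 := div_mul_cancel₀ _ hab.ne'
  have hD1 : (a - b) ^ 2 ≤ D ^ 2 := sq_le_sq' (by linarith [neg_abs_le (a - b)])
    ((le_abs_self _).trans h₁)
  have hx1 : x ≤ 1 := by rw [hx, div_le_one hab]; nlinarith
  have hx2 : -1 ≤ x := by rw [hx, le_div_iff₀ hab]; nlinarith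
  set y : ℝ := √(1 - x ^ 2)
  have hy : y ^ 2 = 1 - x ^ 2 := Real.sq_sqrt (by nlinarith)
  have hd : ∀ s t : ℝ, dist (s • (a : ℂ)) (t • (⟨b * x, b * y⟩ : ℂ)) ^ 2 =
      (s * a) ^ 2 + (t * b) ^ 2 - 2 * (s * a) * (t * b) * x := by
    intro s t
    rw [Complex.dist_eq, ← Complex.normSq_eq_norm_sq, Complex.normSq_apply]
    simp
    linear_combination (t * b) ^ 2 * hy
  refine ⟨(a : ℂ), ⟨b * x, b * y⟩, by simp [abs_of_pos ha], ?_, ?_, ?_⟩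
  · rw [← sq_eq_sq₀ (norm_nonneg _) hb.le, ← Complex.normSq_eq_norm_sq, Complex.normSq_apply]
    linear_combination b ^ 2 * hy
  · rw [← sq_eq_sq₀ dist_nonneg hD]
    have := hd 1 1
    simp only [one_smul] at this
    rw [this]
    linear_combination -hxe
  · intro η
    rw [hd, div_mul_cancel₀ _ ha.ne', div_mul_cancel₀ _ hb.ne']
    linear_combination - η ^ 2 * hxe

theorem IsCAT0.edist_of_straight (hX : IsCAT0 X) {c : ℝ → X} {t u η : ℝ} (ht : 0 < t) (htu : t < u)
    (h₁ : IsometricOn c 0 t) (h₂ : IsometricOn c t u) (hη : 0 < η) (hηt : η ≤ t) (hηu : η ≤ u - t)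
    (h : edist (c (t - η)) (c (t + η)) = ENNReal.ofReal (2 * η)) :
    edist (c 0) (c u) = ENNReal.ofReal u := by
  have hb : 0 < u - t := by linarith
  have e₁ : edist (c t) (c 0) = ENNReal.ofReal t := by
    rw [h₁ t ⟨ht.le, le_rfl⟩ 0 ⟨le_rfl, ht.le⟩, sub_zero, abs_of_pos ht]
  have e₂ : edist (c t) (c u) = ENNReal.ofReal (u - t) := by
    rw [h₂ t ⟨le_rfl, htu.le⟩ u ⟨htu.le, le_rfl⟩, abs_sub_comm, abs_of_pos hb]
  have hle : edist (c 0) (c u) ≤ ENNReal.ofReal u := by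
    refine (edist_triangle_left _ _ (c t)).trans ?_
    rw [e₁, e₂, ← ENNReal.ofReal_add ht.le hb.le]
    simp
  have hfin : edist (c 0) (c u) ≠ ⊤ := ne_top_of_le_ne_top ENNReal.ofReal_ne_top hle
  set D := (edist (c 0) (c u)).toReal with hD
  have hDe : edist (c 0) (c u) = ENNReal.ofReal D := (ENNReal.ofReal_toReal hfin).symm
  have hD0 : 0 ≤ D := ENNReal.toReal_nonneg
  have hDu : D ≤ u := ENNReal.toReal_le_of_le_ofReal (by linarith) hle
  have hDl : |t - (u - t)| ≤ D := by
    have i₁ : t ≤ (u - t) + D := by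
      have := edist_triangle_right (c t) (c 0) (c u)
      rw [e₁, e₂, hDe, ← ENNReal.ofReal_add hb.le hD0] at this
      exact (ENNReal.ofReal_le_ofReal_iff (by positivity)).1 this
    have i₂ : u - t ≤ t + D := by
      have := edist_triangle (c t) (c 0) (c u)
      rw [e₁, e₂, hDe, ← ENNReal.ofReal_add ht.le hD0] at this
      exact (ENNReal.ofReal_le_ofReal_iff (by positivity)).1 this
    rw [abs_le]; constructor <;> linarith
  obtain ⟨q, r, hq, hr, hqr, hqr'⟩ := exists_comparison_triangle ht hb hDl (by linarith)
  have g₁ : IsGeodesic (fun s => c (t - s)) t (c t) (c 0) := by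
    refine ⟨ht.le, by simp, by simp, fun s hs s' hs' => ?_⟩
    rw [h₁ _ ⟨by linarith [hs.2], by linarith [hs.1]⟩ _ ⟨by linarith [hs'.2], by linarith [hs'.1]⟩,
      abs_sub_comm]
    congr 2; ring
  have g₂ : IsGeodesic (fun s => c (t + s)) (u - t) (c t) (c u) := by
    refine ⟨hb.le, by simp, by simp, fun s hs s' hs' => ?_⟩
    rw [h₂ _ ⟨by linarith [hs.1], by linarith [hs.2]⟩ _ ⟨by linarith [hs'.1], by linarith [hs'.2]⟩]
    congr 2; ring
  let ι := Complex.orthonormalBasisOneI.repr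
  have key := hX.2 _ _ _ _ _ _ _ g₁ g₂ (ι 0) (ι q) (ι r)
    (by rw [ι.edist_map, e₁, edist_dist, dist_zero_left, hq])
    (by rw [ι.edist_map, e₂, edist_dist, dist_zero_left, hr])
    (by rw [ι.edist_map, hDe, edist_dist, hqr])
    (η / t) ⟨by positivity, div_le_one_of_le₀ hηt ht.le⟩
    (η / (u - t)) ⟨by positivity, div_le_one_of_le₀ hηu hb.le⟩
  rw [map_zero, AffineMap.lineMap_apply_module, AffineMap.lineMap_apply_module, smul_zero, zero_add,
    smul_zero, zero_add, ← map_smul, ← map_smul, ι.edist_map, div_mul_cancel₀ _ ht.ne',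
    div_mul_cancel₀ _ hb.ne', h, edist_dist, ENNReal.ofReal_le_ofReal_iff dist_nonneg] at key
  have k2 := pow_le_pow_left₀ (by positivity) key 2
  have k3 := mul_le_mul_of_nonneg_right k2 (mul_pos ht hb).le
  rw [hqr'] at k3
  have k4 : u ^ 2 ≤ D ^ 2 := by
    have : η ^ 2 * u ^ 2 ≤ η ^ 2 * D ^ 2 := by nlinarith
    exact le_of_mul_le_mul_left this (by positivity)
  rw [hDe, le_antisymm hDu (abs_le_of_sq_le_sq' k4 hD0).2]

theorem IsCAT0.isometricOn_of_straight (hX : IsCAT0 X) {c : ℝ → X} {t u η : ℝ} (ht : 0 < t)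
    (htu : t < u) (h₁ : IsometricOn c 0 t) (h₂ : IsometricOn c t u) (hη : 0 < η) (hηt : η ≤ t)
    (hηu : η ≤ u - t) (h : edist (c (t - η)) (c (t + η)) = ENNReal.ofReal (2 * η)) :
    IsometricOn c 0 u := by
  have hu := hX.edist_of_straight ht htu h₁ h₂ hη hηt hηu h
  have upper : ∀ s s', 0 ≤ s → s ≤ s' → s' ≤ u → edist (c s) (c s') ≤ ENNReal.ofReal (s' - s) := by
    intro s s' hs hss hsu
    rcases le_total s' t with h' | h'
    · rw [h₁ s ⟨hs, hss.trans h'⟩ s' ⟨hs.trans hss, h'⟩, abs_sub_comm, abs_of_nonneg (by linarith)]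
    rcases le_total t s with h'' | h''
    · rw [h₂ s ⟨h'', by linarith⟩ s' ⟨h', hsu⟩, abs_sub_comm, abs_of_nonneg (by linarith)]
    refine (edist_triangle _ (c t) _).trans ?_
    rw [h₁ s ⟨hs, h''⟩ t ⟨ht.le, le_rfl⟩, h₂ t ⟨le_rfl, htu.le⟩ s' ⟨h', hsu⟩, abs_sub_comm s t,
      abs_sub_comm t s', ← ENNReal.ofReal_add (abs_nonneg _) (abs_nonneg _),
      abs_of_nonneg (by linarith), abs_of_nonneg (by linarith)]
    exact ENNReal.ofReal_le_ofReal (by linarith)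
  have main : ∀ s s', 0 ≤ s → s ≤ s' → s' ≤ u → edist (c s) (c s') = ENNReal.ofReal (s' - s) := by
    intro s s' hs hss hsu
    have hle := upper s s' hs hss hsu
    refine le_antisymm hle ?_
    have hfin : edist (c s) (c s') ≠ ⊤ := ne_top_of_le_ne_top ENNReal.ofReal_ne_top hle
    rw [← ENNReal.ofReal_toReal hfin]
    refine ENNReal.ofReal_le_ofReal ?_
    have := (edist_triangle4 (c 0) (c s) (c s') (c u)).trans
      (add_le_add (add_le_add (upper 0 s le_rfl hs (by linarith))
        (ENNReal.ofReal_toReal hfin).symm.le) (upper s' u (by linarith) hsu le_rfl))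
    rw [hu, ← ENNReal.ofReal_add (by linarith) ENNReal.toReal_nonneg,
      ← ENNReal.ofReal_add (by have : 0 ≤ (edist (c s) (c s')).toReal := ENNReal.toReal_nonneg
                               linarith) (by linarith),
      ENNReal.ofReal_le_ofReal_iff (by
        have : 0 ≤ (edist (c s) (c s')).toReal := ENNReal.toReal_nonneg
        linarith)] at this
    linarith
  intro s hs s' hs'
  rcases le_total s s' with h' | h'
  · rw [main s s' hs.1 h' hs'.2, abs_sub_comm, abs_of_nonneg (by linarith)]
  · rw [edist_comm, main s' s hs'.1 h' hs.2, abs_of_nonneg (by linarith)]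

/-- In a CAT(0) space, a locally isometric path is isometric. -/
theorem IsCAT0.isometricOn_of_local (hX : IsCAT0 X) {c : ℝ → X} {a : ℝ} (ha : 0 ≤ a)
    (h : ∀ t ∈ Set.Icc 0 a, ∃ ε > 0, ∀ s ∈ Set.Icc 0 a, ∀ s' ∈ Set.Icc 0 a,
      |s - t| < ε → |s' - t| < ε → edist (c s) (c s') = ENNReal.ofReal |s - s'|) :
    IsometricOn c 0 a := by
  choose! ε hε hloc using h
  obtain ⟨δ, hδ, hleb⟩ := lebesgue_number_lemma_of_metric (s := Set.Icc 0 a)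
    (c := fun t : Set.Icc 0 a => Metric.ball (t : ℝ) (ε t)) isCompact_Icc
    (fun _ => Metric.isOpen_ball) (fun t ht => Set.mem_iUnion.2
      ⟨⟨t, ht⟩, Metric.mem_ball_self (hε t ht)⟩)
  have unif : ∀ s ∈ Set.Icc 0 a, ∀ s' ∈ Set.Icc 0 a, |s - s'| < δ →
      edist (c s) (c s') = ENNReal.ofReal |s - s'| := by
    intro s hs s' hs' hss
    obtain ⟨t, ht⟩ := hleb s hs
    have m₁ := ht (Metric.mem_ball_self hδ)
    have m₂ : s' ∈ Metric.ball (t : ℝ) (ε t) := ht (by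
      rw [Metric.mem_ball, Real.dist_eq, abs_sub_comm]; exact hss)
    rw [Metric.mem_ball, Real.dist_eq] at m₁ m₂
    exact hloc t t.2 s hs s' hs' m₁ m₂
  have step : ∀ k : ℕ, IsometricOn c 0 (min a (k * (δ / 3))) := by
    intro k
    induction k with
    | zero =>
      intro s hs s' hs'
      simp only [CharP.cast_eq_zero, zero_mul, min_eq_right ha, Set.Icc_self,
        Set.mem_singleton_iff] at hs hs'
      simp [hs, hs']
    | succ k ih =>
      set t := min a (k * (δ / 3)) with ht
      set u := min a ((k + 1 : ℕ) * (δ / 3)) with hu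
      have hua : u ≤ a := min_le_left _ _
      have hu' : u ≤ t + δ / 3 := by
        rw [ht, ← min_add_add_right]
        refine min_le_min (by linarith) ?_
        push_cast; linarith
      have htu : t ≤ u := min_le_min le_rfl (by push_cast; nlinarith)
      have ht0 : 0 ≤ t := le_min ha (by positivity)
      rcases htu.eq_or_lt with htu | htu
      · rwa [← htu]
      have h₂ : IsometricOn c t u := by
        intro s hs s' hs'
        refine unif s ⟨by linarith [hs.1], by linarith [hs.2]⟩ s'
          ⟨by linarith [hs'.1], by linarith [hs'.2]⟩ ?_
        rw [abs_lt]
        constructor <;> linarith [hs.1, hs.2, hs'.1, hs'.2]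
      rcases ht0.eq_or_lt with ht0 | ht0
      · rwa [← ht0] at h₂
      have hη : 0 < min t (u - t) := lt_min ht0 (by linarith)
      have hη1 : min t (u - t) ≤ t := min_le_left _ _
      have hη2 : min t (u - t) ≤ u - t := min_le_right _ _
      refine hX.isometricOn_of_straight ht0 htu ih h₂ hη hη1 hη2 ?_
      rw [unif _ ⟨by linarith, by linarith⟩ _ ⟨by linarith, by linarith⟩]
      · rw [abs_sub_comm, abs_of_nonneg (by linarith)]
        congr 1; ring
      · rw [abs_lt]
        constructor <;> linarith
  obtain ⟨k, hk⟩ := exists_nat_gt (a / (δ / 3))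
  rw [div_lt_iff₀ (by positivity)] at hk
  have := step k
  rwa [min_eq_left hk.le] at this

end CAT0

/-! ### The corners of regular polygons -/

section Corners

/-- The radius of the circle through the vertices of a regular `n`-gon of side length `1`. -/
def circumradius (n : ℕ) : ℝ := 1 / (2 * Real.sin (Real.pi / n))

/-- The rotation by an `n`-th of a full turn. -/
def turn (n : ℕ) : ℂ := Complex.exp (2 * Real.pi * Complex.I / n)

theorem sin_pi_div_pos {n : ℕ} (hn : 2 ≤ n) : 0 < Real.sin (Real.pi / n) := by
  have h2 : (2 : ℝ) ≤ n := by exact_mod_cast hn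
  apply Real.sin_pos_of_pos_of_lt_pi (by positivity)
  rw [div_lt_iff₀ (by positivity)]
  nlinarith [Real.pi_pos]

theorem half_le_circumradius {n : ℕ} (hn : 2 ≤ n) : 1 / 2 ≤ circumradius n := by
  have := sin_pi_div_pos hn
  exact one_div_le_one_div_of_le (by positivity) (by linarith [Real.sin_le_one (Real.pi / n)])

theorem circumradius_pos {n : ℕ} (hn : 2 ≤ n) : 0 < circumradius n := by
  linarith [half_le_circumradius hn]

theorem corner_eq (n : ℕ) (k : Fin n) : corner n k = circumradius n * turn n ^ (k : ℕ) := by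
  rw [corner, circumradius, turn, ← Complex.exp_nat_mul]
  congr 2
  ring

theorem turn_pow_self {n : ℕ} (hn : n ≠ 0) : turn n ^ n = 1 := by
  rw [turn, ← Complex.exp_nat_mul, mul_div_cancel₀ _ (by exact_mod_cast hn)]
  exact Complex.exp_two_pi_mul_I

theorem turn_eq (n : ℕ) : turn n = Complex.exp (Complex.I * (2 * Real.pi / n : ℝ)) := by
  rw [turn]; congr 1; push_cast; ring

theorem norm_turn (n : ℕ) : ‖turn n‖ = 1 := by
  rw [turn_eq, mul_comm, Complex.norm_exp_ofReal_mul_I]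

theorem turn_pow_add {n : ℕ} [NeZero n] (i j : Fin n) :
    turn n ^ ((i + j : Fin n) : ℕ) = turn n ^ (i : ℕ) * turn n ^ (j : ℕ) := by
  rw [Fin.val_add, ← pow_add, ← pow_mod_orderOf, ← pow_mod_orderOf _ (i + j : ℕ),
    Nat.mod_mod_of_dvd _ (orderOf_dvd_of_pow_eq_one (turn_pow_self (NeZero.ne n)))]

theorem norm_corner (n : ℕ) (hn : 2 ≤ n) (k : Fin n) : ‖corner n k‖ = circumradius n := by
  rw [corner_eq, norm_mul, norm_pow, norm_turn, one_pow, mul_one, Complex.norm_real,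
    Real.norm_of_nonneg (circumradius_pos hn).le]

theorem dist_corner_add {n : ℕ} [NeZero n] (hn : 2 ≤ n) (k j : Fin n) :
    dist (corner n (k + j)) (corner n k) = circumradius n * ‖turn n ^ (j : ℕ) - 1‖ := by
  rw [corner_eq, corner_eq, turn_pow_add, Complex.dist_eq, ← mul_sub, ← mul_sub_one, norm_mul,
    norm_mul, norm_pow, norm_turn, one_pow, one_mul, Complex.norm_real,
    Real.norm_of_nonneg (circumradius_pos hn).le]

theorem circumradius_mul_norm_turn_sub_one {n : ℕ} (hn : 2 ≤ n) :
    circumradius n * ‖turn n - 1‖ = 1 := by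
  have := sin_pi_div_pos hn
  rw [turn_eq, Complex.norm_exp_I_mul_ofReal_sub_one,
    show 2 * Real.pi / n / 2 = Real.pi / n by ring, Real.norm_of_nonneg (by positivity),
    circumradius, one_div_mul_cancel (by positivity)]

theorem dist_corner_of_adj {n : ℕ} {i j : Fin (n + 2)} (h : (SimpleGraph.cycleGraph (n + 2)).Adj i j) :
    dist (corner (n + 2) i) (corner (n + 2) j) = 1 := by
  have key : ∀ k : Fin (n + 2), dist (corner (n + 2) (k + 1)) (corner (n + 2) k) = 1 := by
    intro k
    rw [dist_corner_add (by omega)]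
    simpa using circumradius_mul_norm_turn_sub_one (n := n + 2) (by omega)
  rcases SimpleGraph.cycleGraph_adj.1 h with h | h
  · obtain rfl := sub_eq_iff_eq_add'.1 h
    exact key _
  · obtain rfl := sub_eq_iff_eq_add'.1 h
    rw [dist_comm, key]

theorem cos_two_pi_div_five : 4 * Real.cos (2 * Real.pi / 5) ^ 2 + 2 * Real.cos (2 * Real.pi / 5) = 1 := by
  have h5 : √(5 : ℝ) ^ 2 = 5 := Real.sq_sqrt (by norm_num)
  rw [show 2 * Real.pi / 5 = 2 * (Real.pi / 5) by ring, Real.cos_two_mul, Real.cos_pi_div_five]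
  ring_nf
  rw [show √(5 : ℝ) ^ 4 = (√5 ^ 2) ^ 2 by ring, show √(5 : ℝ) ^ 3 = √5 ^ 2 * √5 by ring, h5]
  ring

theorem cos_two_pi_div_five_pos : 0 < Real.cos (2 * Real.pi / 5) :=
  Real.cos_pos_of_mem_Ioo ⟨by linarith [Real.pi_pos], by linarith [Real.pi_pos]⟩

theorem sin_two_pi_div_five_pos : 0 < Real.sin (2 * Real.pi / 5) :=
  Real.sin_pos_of_pos_of_lt_pi (by linarith [Real.pi_pos]) (by linarith [Real.pi_pos])

theorem circumradius_five_mul_norm_turn_sq_sub_one :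
    circumradius 5 * ‖turn 5 ^ 2 - 1‖ = 2 * Real.cos (Real.pi / 5) := by
  have h5 : (0 : ℝ) < Real.sin (Real.pi / 5) := by simpa using sin_pi_div_pos (n := 5) (by norm_num)
  rw [turn_eq, ← Complex.exp_nat_mul,
    show ((2 : ℕ) : ℂ) * (Complex.I * ((2 * Real.pi / (5 : ℕ) : ℝ) : ℂ)) =
      Complex.I * ((4 * Real.pi / 5 : ℝ) : ℂ) by push_cast; ring,
    Complex.norm_exp_I_mul_ofReal_sub_one, show 4 * Real.pi / 5 / 2 = 2 * (Real.pi / 5) by ring,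
    Real.sin_two_mul, circumradius]
  have h : 0 < Real.cos (Real.pi / 5) :=
    Real.cos_pos_of_mem_Ioo ⟨by linarith [Real.pi_pos], by linarith [Real.pi_pos]⟩
  rw [Real.norm_of_nonneg (by positivity)]
  push_cast
  field_simp

/-- Two different neighbours of a corner of a pentagon are at distance `2 cos 36°`. -/
theorem dist_corner_of_adj_of_adj {i j k : Fin 5} (hi : (SimpleGraph.cycleGraph 5).Adj k i)
    (hj : (SimpleGraph.cycleGraph 5).Adj k j) (hij : i ≠ j) :
    dist (corner 5 i) (corner 5 j) = 2 * Real.cos (Real.pi / 5) := by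
  have key : ∀ m : Fin 5, dist (corner 5 (m + 2)) (corner 5 m) = 2 * Real.cos (Real.pi / 5) := by
    intro m
    rw [dist_corner_add (by norm_num)]
    simpa using circumradius_five_mul_norm_turn_sq_sub_one
  have h : i = j + 2 ∨ j = i + 2 := by
    revert i j k
    simp only [SimpleGraph.cycleGraph_adj]
    decide
  rcases h with rfl | rfl
  · exact key _
  · rw [dist_comm, key]

theorem sum_mul_corner {n : ℕ} [NeZero n] (f : Fin n → ℝ) (j : Fin n) :
    ∑ i, (f i : ℂ) * corner n i =
      circumradius n * turn n ^ (j : ℕ) * ∑ k, (f (k + j) : ℂ) * turn n ^ (k : ℕ) := by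
  rw [← Equiv.sum_comp (Equiv.addRight j), Finset.mul_sum]
  refine Finset.sum_congr rfl fun k _ => ?_
  rw [Equiv.coe_addRight, corner_eq, turn_pow_add]
  ring

theorem norm_sum_mul_corner_sub {n : ℕ} [NeZero n] (hn : 2 ≤ n) (f g : Fin n → ℝ) (j : Fin n) :
    ‖(∑ k, (f (k + j) : ℂ) * turn n ^ (k : ℕ)) - ∑ k, (g (k + j) : ℂ) * turn n ^ (k : ℕ)‖ ≤
      2 * ‖(∑ i, (f i : ℂ) * corner n i) - ∑ i, (g i : ℂ) * corner n i‖ := by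
  rw [sum_mul_corner f j, sum_mul_corner g j, ← mul_sub, norm_mul, norm_mul, norm_pow, norm_turn,
    one_pow, mul_one, Complex.norm_real, Real.norm_of_nonneg (circumradius_pos hn).le]
  nlinarith [half_le_circumradius hn, norm_nonneg
    ((∑ k, (f (k + j) : ℂ) * turn n ^ (k : ℕ)) - ∑ k, (g (k + j) : ℂ) * turn n ^ (k : ℕ))]

theorem turn_two : turn 2 = -1 := by
  rw [turn, ← Complex.exp_pi_mul_I]; congr 1; push_cast; ring

theorem abs_sub_le_of_edge (f g : Fin 2 → ℝ) (hf : ∑ i, f i = 1) (hg : ∑ i, g i = 1) (j : Fin 2) :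
    |f j - g j| ≤ 4 * ‖(∑ i, (f i : ℂ) * corner 2 i) - ∑ i, (g i : ℂ) * corner 2 i‖ := by
  have h := norm_sum_mul_corner_sub le_rfl f g j
  have hf' : f (0 + j) + f (1 + j) = 1 := by
    rw [← hf, ← Equiv.sum_comp (Equiv.addRight j)]; simp
  have hg' : g (0 + j) + g (1 + j) = 1 := by
    rw [← hg, ← Equiv.sum_comp (Equiv.addRight j)]; simp
  rw [Fin.sum_univ_two, Fin.sum_univ_two, turn_two] at h
  have h' := (Complex.abs_re_le_norm _).trans h
  simp only [Fin.val_zero, Fin.val_one, pow_zero, pow_one, Complex.sub_re, Complex.add_re,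
    Complex.ofReal_re, Complex.neg_re, mul_one, mul_neg] at h'
  rw [zero_add] at hf' hg' h'
  rw [show f j + -f (1 + j) - (g j + -g (1 + j)) = 2 * (f j - g j) by linarith, abs_mul,
    abs_two] at h'
  linarith [abs_nonneg (f j - g j)]

theorem turn_re (n : ℕ) : (turn n).re = Real.cos (2 * Real.pi / n) := by
  rw [turn_eq, mul_comm, Complex.exp_ofReal_mul_I_re]

theorem turn_im (n : ℕ) : (turn n).im = Real.sin (2 * Real.pi / n) := by
  rw [turn_eq, mul_comm, Complex.exp_ofReal_mul_I_im]

theorem cos_two_pi_div_three : Real.cos (2 * Real.pi / 3) = -1 / 2 := by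
  rw [show 2 * Real.pi / 3 = Real.pi - Real.pi / 3 by ring, Real.cos_pi_sub, Real.cos_pi_div_three]
  norm_num

theorem abs_sub_le_of_triangle (f g : Fin 3 → ℝ) (hf : ∑ i, f i = 1) (hg : ∑ i, g i = 1)
    (j : Fin 3) :
    |f j - g j| ≤ 4 * ‖(∑ i, (f i : ℂ) * corner 3 i) - ∑ i, (g i : ℂ) * corner 3 i‖ := by
  have h := norm_sum_mul_corner_sub (by norm_num) f g j
  have hf' : f (0 + j) + f (1 + j) + f (2 + j) = 1 := by
    rw [← hf, ← Equiv.sum_comp (Equiv.addRight j), Fin.sum_univ_three]; simp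
  have hg' : g (0 + j) + g (1 + j) + g (2 + j) = 1 := by
    rw [← hg, ← Equiv.sum_comp (Equiv.addRight j), Fin.sum_univ_three]; simp
  rw [Fin.sum_univ_three, Fin.sum_univ_three] at h
  have h' := (Complex.abs_re_le_norm _).trans h
  have hr : (turn 3).re = -1 / 2 := by rw [turn_re]; exact_mod_cast cos_two_pi_div_three
  have hi : (turn 3).im ^ 2 = 3 / 4 := by
    have := Complex.normSq_eq_norm_sq (turn 3)
    rw [norm_turn, Complex.normSq_apply, hr] at this
    linarith
  have hr2 : (turn 3 ^ 2).re = -1 / 2 := by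
    rw [sq, Complex.mul_re, hr, ← sq (turn 3).im, hi]; norm_num
  simp only [Fin.val_zero, Fin.val_one, Fin.val_two, pow_zero, pow_one, Complex.sub_re,
    Complex.add_re, Complex.re_ofReal_mul, Complex.ofReal_re, hr, hr2, zero_add, mul_one] at h'
  rw [zero_add] at hf' hg'
  rw [show f j + f (1 + j) * (-1 / 2) + f (2 + j) * (-1 / 2) -
    (g j + g (1 + j) * (-1 / 2) + g (2 + j) * (-1 / 2)) = 3 / 2 * (f j - g j) by linarith, abs_mul,
    abs_of_pos (by norm_num : (0 : ℝ) < 3 / 2)] at h'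
  linarith [abs_nonneg (f j - g j)]

/-- The barycentric coordinate of a corner of a pentagon, in the triangulation by the centre. -/
theorem eq_hat_of_pentagon (f : Fin 5 → ℝ) (hf : ∀ i, 0 ≤ f i) (h : ∀ i, f i = 0 ∨ f (i + 2) = 0) :
    f 0 = max 0 ((∑ k, (f k : ℂ) * turn 5 ^ (k : ℕ)).re -
      Real.cos (2 * Real.pi / 5) / Real.sin (2 * Real.pi / 5) *
        |(∑ k, (f k : ℂ) * turn 5 ^ (k : ℕ)).im|) := by
  set c := Real.cos (2 * Real.pi / 5) with hc
  set s := Real.sin (2 * Real.pi / 5) with hs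
  have hc1 : 4 * c ^ 2 + 2 * c = 1 := cos_two_pi_div_five
  have hc0 : 0 < c := cos_two_pi_div_five_pos
  have hs0 : 0 < s := sin_two_pi_div_five_pos
  have hsc : s ^ 2 + c ^ 2 = 1 := Real.sin_sq_add_cos_sq _
  have r1 : (turn 5).re = c := by rw [turn_re]; norm_num [hc]
  have i1 : (turn 5).im = s := by rw [turn_im]; norm_num [hs]
  have r2 : (turn 5 ^ 2).re = -c - 1 / 2 := by rw [sq, Complex.mul_re, r1, i1]; nlinarith
  have i2 : (turn 5 ^ 2).im = 2 * c * s := by rw [sq, Complex.mul_im, r1, i1]; ring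
  have r3 : (turn 5 ^ 3).re = -c - 1 / 2 := by
    rw [pow_succ, Complex.mul_re, r1, i1, r2, i2]
    have : s ^ 2 = 1 - c ^ 2 := by linarith
    linear_combination (-2 * c) * this + (c / 2 - 1 / 2) * hc1
  have i3 : (turn 5 ^ 3).im = -(2 * c * s) := by
    rw [pow_succ, Complex.mul_im, r1, i1, r2, i2]
    linear_combination (s / 2) * hc1
  have r4 : (turn 5 ^ 4).re = c := by
    rw [pow_succ, Complex.mul_re, r1, i1, r3, i3]
    have : s ^ 2 = 1 - c ^ 2 := by linarith
    linear_combination (2 * c) * this + (-c / 2) * hc1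
  have i4 : (turn 5 ^ 4).im = -s := by
    rw [pow_succ, Complex.mul_im, r1, i1, r3, i3]
    linear_combination (-s / 2) * hc1
  have hre : (∑ k, (f k : ℂ) * turn 5 ^ (k : ℕ)).re =
      f 0 + c * (f 1 + f 4) - (c + 1 / 2) * (f 2 + f 3) := by
    rw [Fin.sum_univ_five]
    simp only [Complex.add_re, Complex.re_ofReal_mul, Fin.val_zero, Fin.val_one, Fin.val_two,
      show ((3 : Fin 5) : ℕ) = 3 from rfl, show ((4 : Fin 5) : ℕ) = 4 from rfl, pow_zero, pow_one,
      Complex.one_re, r1, r2, r3, r4]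
    ring
  have him : (∑ k, (f k : ℂ) * turn 5 ^ (k : ℕ)).im =
      s * ((f 1 - f 4) + 2 * c * (f 2 - f 3)) := by
    rw [Fin.sum_univ_five]
    simp only [Complex.add_im, Complex.im_ofReal_mul, Fin.val_zero, Fin.val_one, Fin.val_two,
      show ((3 : Fin 5) : ℕ) = 3 from rfl, show ((4 : Fin 5) : ℕ) = 4 from rfl, pow_zero, pow_one,
      Complex.one_im, i1, i2, i3, i4]
    ring
  rw [hre, him, abs_mul, abs_of_pos hs0, ← mul_assoc, div_mul_cancel₀ _ hs0.ne']
  have h02 := h 0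
  have h13 := h 1
  have h24 := h 2
  have h30 := h 3
  have h41 := h 4
  simp only [show (1 : Fin 5) + 2 = 3 from rfl, show (2 : Fin 5) + 2 = 4 from rfl,
    show (3 : Fin 5) + 2 = 0 from rfl, show (4 : Fin 5) + 2 = 1 from rfl, zero_add] at h02 h13 h24 h30 h41
  have p0 := hf 0
  have p1 := hf 1
  have p2 := hf 2
  have p3 := hf 3
  have p4 := hf 4
  by_cases z : f 2 = 0 ∧ f 3 = 0
  · rw [z.1, z.2]
    rcases h41 with h41 | h41
    · rw [h41, sub_zero, sub_zero, mul_zero, add_zero, abs_of_nonneg p1, max_eq_right] <;> nlinarith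
    · rw [h41, sub_zero, mul_zero, add_zero, zero_sub, add_zero, abs_neg, abs_of_nonneg p4, max_eq_right] <;>
        nlinarith
  · have z0 : f 0 = 0 := by tauto
    rw [z0, max_eq_left]
    have hc2 : c < 1 / 2 := by nlinarith
    have q1 := abs_nonneg (f 1 - f 4 + 2 * c * (f 2 - f 3))
    have q2 := le_abs_self (f 1 - f 4 + 2 * c * (f 2 - f 3))
    have q3 := neg_abs_le (f 1 - f 4 + 2 * c * (f 2 - f 3))
    have u1 := mul_le_mul_of_nonneg_left q2 hc0.le
    have u2 := mul_le_mul_of_nonneg_left q3 hc0.le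
    have u0 := mul_nonneg hc0.le q1
    have v2 : 0 ≤ c * f 2 := by positivity
    have v3 : 0 ≤ c * f 3 := by positivity
    have e2 : c * (2 * c * (f 2 - f 3)) = (1 / 2 - c) * (f 2 - f 3) := by
      linear_combination ((f 2 - f 3) / 2) * hc1
    rw [mul_add, e2] at u1
    rw [mul_neg, mul_add c (f 1 - f 4), e2] at u2
    generalize |f 1 - f 4 + 2 * c * (f 2 - f 3)| = A at *
    rcases h41.symm with h41 | h41
    · rcases h24 with h24 | h24
      · rw [h41, h24] at u2 ⊢; linarith
      · rw [h41, h24]; linarith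
    · rcases h13 with h13 | h13
      · rw [h41, h13]; linarith
      · rw [h41, h13] at u1 ⊢; linarith

theorem abs_sub_le_of_pentagon (f g : Fin 5 → ℝ) (hf : ∀ i, 0 ≤ f i)
    (hf' : ∀ i, f i = 0 ∨ f (i + 2) = 0) (hg : ∀ i, 0 ≤ g i) (hg' : ∀ i, g i = 0 ∨ g (i + 2) = 0)
    (j : Fin 5) :
    |f j - g j| ≤ 4 * ‖(∑ i, (f i : ℂ) * corner 5 i) - ∑ i, (g i : ℂ) * corner 5 i‖ := by
  have h := norm_sum_mul_corner_sub (by norm_num) f g j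
  have ef := eq_hat_of_pentagon (fun k => f (k + j)) (fun _ => hf _)
    (fun i => by rw [add_right_comm]; exact hf' _)
  have eg := eq_hat_of_pentagon (fun k => g (k + j)) (fun _ => hg _)
    (fun i => by rw [add_right_comm]; exact hg' _)
  simp only [zero_add] at ef eg
  set Z := ∑ k, (f (k + j) : ℂ) * turn 5 ^ (k : ℕ)
  set Z' := ∑ k, (g (k + j) : ℂ) * turn 5 ^ (k : ℕ)
  rw [ef, eg]
  set c := Real.cos (2 * Real.pi / 5)
  set s := Real.sin (2 * Real.pi / 5)
  have hc1 : 4 * c ^ 2 + 2 * c = 1 := cos_two_pi_div_five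
  have hc0 : 0 < c := cos_two_pi_div_five_pos
  have hs0 : 0 < s := sin_two_pi_div_five_pos
  have hsc : s ^ 2 + c ^ 2 = 1 := Real.sin_sq_add_cos_sq _
  have hκ : c / s ≤ 1 := by rw [div_le_one hs0]; nlinarith
  have hκ0 : 0 ≤ c / s := by positivity
  have h1 := Complex.abs_re_le_norm (Z - Z')
  have h2 := Complex.abs_im_le_norm (Z - Z')
  rw [Complex.sub_re] at h1
  rw [Complex.sub_im] at h2
  have h3 := abs_abs_sub_abs_le Z.im Z'.im
  refine le_trans ?_ (by linarith : 2 * ‖Z - Z'‖ ≤ _)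
  rw [max_comm, max_comm 0]
  refine (abs_max_sub_max_le_abs _ _ _).trans ?_
  rw [sub_sub_sub_comm, ← mul_sub]
  refine (abs_sub _ _).trans ?_
  rw [abs_mul, abs_of_nonneg hκ0]
  have := mul_le_mul hκ (h3.trans h2) (abs_nonneg _) zero_le_one
  linarith

end Corners

/-! ### Simplices of the subdivision and cells -/

section Cells

variable {V : Type*} {G : SimpleGraph V}

theorem adj_of_mem_face {s : Finset (V ⊕ Pentagon G)} (hs : s ∈ (subdivision G).faces) {u w : V}
    (hu : Sum.inl u ∈ s) (hw : Sum.inl w ∈ s) (h : u ≠ w) : G.Adj u w := by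
  obtain ⟨-, B, hB, hsB⟩ := hs
  have hu' := hsB hu
  have hw' := hsB hw
  rcases hB with ((⟨a, rfl⟩ | ⟨a, b, hab, rfl⟩) | ⟨a, b, c, hab, hbc, hac, rfl⟩) |
    ⟨P, a, b, -, -, hab, rfl⟩ <;>
  simp only [Set.mem_insert_iff, Set.mem_singleton_iff, Sum.inl.injEq, reduceCtorEq,
    false_or] at hu' hw' <;>
  grind [SimpleGraph.Adj.symm]

theorem mem_of_mem_face {s : Finset (V ⊕ Pentagon G)} (hs : s ∈ (subdivision G).faces) {u : V}
    {P : Pentagon G} (hu : Sum.inl u ∈ s) (hP : Sum.inr P ∈ s) : u ∈ P.1 := by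
  obtain ⟨-, B, hB, hsB⟩ := hs
  have hu' := hsB hu
  have hP' := hsB hP
  rcases hB with ((⟨a, rfl⟩ | ⟨a, b, hab, rfl⟩) | ⟨a, b, c, hab, hbc, hac, rfl⟩) |
    ⟨Q, a, b, ha, hb, hab, rfl⟩ <;>
  simp only [Set.mem_insert_iff, Set.mem_singleton_iff, Sum.inl.injEq, Sum.inr.injEq, reduceCtorEq,
    false_or, or_false] at hu' hP'
  rcases hu' with rfl | rfl <;> rwa [hP']

theorem eq_of_mem_face {s : Finset (V ⊕ Pentagon G)} (hs : s ∈ (subdivision G).faces)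
    {P Q : Pentagon G} (hP : Sum.inr P ∈ s) (hQ : Sum.inr Q ∈ s) : P = Q := by
  obtain ⟨-, B, hB, hsB⟩ := hs
  have hQ' := hsB hQ
  have hP' := hsB hP
  rcases hB with ((⟨a, rfl⟩ | ⟨a, b, hab, rfl⟩) | ⟨a, b, c, hab, hbc, hac, rfl⟩) |
    ⟨R, a, b, ha, hb, hab, rfl⟩ <;>
  simp only [Set.mem_insert_iff, Set.mem_singleton_iff, Sum.inr.injEq, reduceCtorEq,
    or_false] at hQ' hP'
  rw [hP', hQ']

theorem mem_faces_of_subset {W : Type*} {K : PreAbstractSimplicialComplex W} {s t : Finset W}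
    (ht : t ∈ K.faces) (h : s ⊆ t) (hs : s.Nonempty) : s ∈ K.faces :=
  (K.isRelLowerSet_faces ht).2 h hs

theorem coord_nonneg (x : Space G) (w : V ⊕ Pentagon G) : 0 ≤ x.1 w := x.2.2.1 w

theorem sum_coord (x : Space G) {s : Finset (V ⊕ Pentagon G)} (h : x.1.support ⊆ s) :
    ∑ w ∈ s, x.1 w = 1 := by
  exact (Finsupp.sum_of_support_subset _ h _ fun _ _ => rfl).symm.trans x.2.2.2

/-- The barycentric coordinates of a point of a cell at the vertices of the cell. -/
def Cell.weight (C : Cell G) (x : Space G) (i : Fin C.n) : ℝ := x.1 (Sum.inl (C.vertex i))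

theorem Cell.two_le (C : Cell G) : 2 ≤ C.n := by
  rcases C.hn with h | h | h <;> omega

theorem Pentagon.exists_embedding (P : Pentagon G) :
    ∃ φ : SimpleGraph.cycleGraph 5 ↪g G, Set.range φ = P.1 := P.2

theorem Cell.n_eq_five {C : Cell G} {P : Pentagon G} (h : P.1 = Set.range C.vertex) : C.n = 5 := by
  obtain ⟨φ, hφ⟩ := P.exists_embedding
  have h1 := Nat.card_range_of_injective C.vertex.injective
  rw [← h, ← hφ, Nat.card_range_of_injective φ.injective] at h1
  simpa using h1.symm

/-- The positions of the vertices in the chart of a cell. -/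
def Cell.pos (C : Cell G) (w : V ⊕ Pentagon G) : ℂ :=
  open Classical in ∑ i, if w = Sum.inl (C.vertex i) then corner C.n i else 0

theorem Cell.pos_inl (C : Cell G) (i : Fin C.n) : C.pos (Sum.inl (C.vertex i)) = corner C.n i := by
  classical
  rw [Cell.pos, Finset.sum_eq_single i]
  · rw [if_pos rfl]
  · intro j _ hj
    rw [if_neg]
    intro h
    exact hj (C.vertex.injective (Sum.inl.inj h)).symm
  · simp

theorem Cell.pos_inr (C : Cell G) (P : Pentagon G) : C.pos (Sum.inr P) = 0 := by
  simp [Cell.pos]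

theorem Cell.chart_eq (C : Cell G) (x : Space G) {s : Finset (V ⊕ Pentagon G)}
    (h : x.1.support ⊆ s) : C.chart x = ∑ w ∈ s, x.1 w • C.pos w := by
  classical
  simp_rw [Cell.pos, Finset.smul_sum]
  rw [Finset.sum_comm, Cell.chart]
  refine Finset.sum_congr rfl fun i _ => ?_
  by_cases hi : Sum.inl (C.vertex i) ∈ s
  · rw [Finset.sum_eq_single_of_mem _ hi (fun w _ hw => by rw [if_neg hw, smul_zero]), if_pos rfl,
      Complex.real_smul]
  · rw [Finset.sum_eq_zero, Finsupp.notMem_support_iff.1 fun h' => hi (h h'), Complex.ofReal_zero,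
      zero_mul]
    intro w hw
    rw [if_neg (by rintro rfl; exact hi hw), smul_zero]

theorem Cell.sum_weight_of_ne_five {C : Cell G} (h5 : C.n ≠ 5) {x : Space G} (hx : C.Contains x) :
    ∑ i, C.weight x i = 1 := by
  let e : Fin C.n ↪ V ⊕ Pentagon G := C.vertex.toEmbedding.trans ⟨Sum.inl, Sum.inl_injective⟩
  refine Eq.trans ?_ (sum_coord x (s := Finset.univ.map e) ?_)
  · rw [Finset.sum_map]; rfl
  · intro a ha
    rcases hx a ha with ⟨i, rfl⟩ | ⟨P, hP, -⟩
    · exact Finset.mem_map_of_mem e (Finset.mem_univ i)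
    · exact absurd (Cell.n_eq_five hP) h5

theorem Cell.sum_weight_add {C : Cell G} {P : Pentagon G} (hP : P.1 = Set.range C.vertex)
    {x : Space G} (hx : C.Contains x) : ∑ i, C.weight x i + x.1 (Sum.inr P) = 1 := by
  let e : Fin C.n ↪ V ⊕ Pentagon G := C.vertex.toEmbedding.trans ⟨Sum.inl, Sum.inl_injective⟩
  have hn : Sum.inr P ∉ Finset.univ.map e := by
    simp only [Finset.mem_map, not_exists, not_and]
    intro i _ h
    cases h
  refine Eq.trans ?_ (sum_coord x (s := Finset.cons (Sum.inr P) (Finset.univ.map e) hn) ?_)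
  · rw [Finset.sum_cons, Finset.sum_map, add_comm]; rfl
  · intro a ha
    rcases hx a ha with ⟨i, rfl⟩ | ⟨Q, hQ, rfl⟩
    · exact Finset.mem_cons.2 (Or.inr (Finset.mem_map_of_mem e (Finset.mem_univ i)))
    · obtain rfl : Q = P := Subtype.ext (hQ.trans hP.symm)
      exact Finset.mem_cons_self _ _

theorem Cell.weight_eq_zero_or (C : Cell G) (x : Space G) {i j : Fin C.n} (hij : i ≠ j)
    (h : ¬ (SimpleGraph.cycleGraph C.n).Adj i j) : C.weight x i = 0 ∨ C.weight x j = 0 := by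
  by_contra! hne
  refine h (C.vertex.map_rel_iff.1 ?_)
  exact adj_of_mem_face x.2.1 (Finsupp.mem_support_iff.2 hne.1) (Finsupp.mem_support_iff.2 hne.2)
    (fun h => hij (C.vertex.injective h))

theorem Cell.abs_weight_sub_le (C : Cell G) {x y : Space G} (hx : C.Contains x) (hy : C.Contains y)
    (i : Fin C.n) : |C.weight x i - C.weight y i| ≤ 4 * dist (C.chart x) (C.chart y) := by
  rw [Complex.dist_eq]
  rcases C with ⟨n, hn | hn | hn, φ⟩ <;> subst hn
  · exact abs_sub_le_of_edge _ _ (Cell.sum_weight_of_ne_five (by norm_num) hx)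
      (Cell.sum_weight_of_ne_five (by norm_num) hy) i
  · exact abs_sub_le_of_triangle _ _ (Cell.sum_weight_of_ne_five (by norm_num) hx)
      (Cell.sum_weight_of_ne_five (by norm_num) hy) i
  · have key : ∀ z : Space G, ∀ i : Fin 5, z.1 (Sum.inl (φ i)) = 0 ∨ z.1 (Sum.inl (φ (i + 2))) = 0 := by
      intro z i
      refine Cell.weight_eq_zero_or ⟨5, Or.inr (Or.inr rfl), φ⟩ z (i := i) (j := i + 2) ?_ ?_
      · exact (by decide : ∀ i : Fin 5, i ≠ i + 2) i
      · exact (by simp only [SimpleGraph.cycleGraph_adj]; decide :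
          ∀ i : Fin 5, ¬ (SimpleGraph.cycleGraph 5).Adj i (i + 2)) i
    exact abs_sub_le_of_pentagon _ _ (fun _ => coord_nonneg _ _) (key x) (fun _ => coord_nonneg _ _)
      (key y) i

/-- The barycentric coordinates are Lipschitz functions on the cells. -/
theorem Cell.abs_coord_sub_le (C : Cell G) {x y : Space G} (hx : C.Contains x) (hy : C.Contains y)
    (w : V ⊕ Pentagon G) : |x.1 w - y.1 w| ≤ 20 * dist (C.chart x) (C.chart y) := by
  have hd : 0 ≤ dist (C.chart x) (C.chart y) := dist_nonneg
  have zero : (¬ ∃ i, w = Sum.inl (C.vertex i)) →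
      (¬ ∃ P : Pentagon G, P.1 = Set.range C.vertex ∧ w = Sum.inr P) →
      |x.1 w - y.1 w| ≤ 20 * dist (C.chart x) (C.chart y) := by
    intro h1 h2
    have e : ∀ z : Space G, C.Contains z → z.1 w = 0 := by
      intro z hz
      by_contra hne
      rcases hz w (Finsupp.mem_support_iff.2 hne) with h | h
      exacts [h1 h, h2 h]
    rw [e x hx, e y hy, sub_zero, abs_zero]
    positivity
  by_cases h1 : ∃ i, w = Sum.inl (C.vertex i)
  · obtain ⟨i, rfl⟩ := h1
    have := C.abs_weight_sub_le hx hy i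
    simp only [Cell.weight] at this
    linarith
  by_cases h2 : ∃ P : Pentagon G, P.1 = Set.range C.vertex ∧ w = Sum.inr P
  · obtain ⟨P, hP, rfl⟩ := h2
    have e1 := Cell.sum_weight_add hP hx
    have e2 := Cell.sum_weight_add hP hy
    rw [show x.1 (Sum.inr P) - y.1 (Sum.inr P) = ∑ i, (C.weight y i - C.weight x i) by
      rw [Finset.sum_sub_distrib]; linarith]
    refine (Finset.abs_sum_le_sum_abs _ _).trans ?_
    refine (Finset.sum_le_card_nsmul _ _ (4 * dist (C.chart x) (C.chart y)) fun i _ => ?_).trans ?_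
    · rw [abs_sub_comm]; exact C.abs_weight_sub_le hx hy i
    · simp only [Finset.card_univ, Fintype.card_fin, Cell.n_eq_five hP, nsmul_eq_mul]
      push_cast
      linarith
  · exact zero h1 h2

theorem IsString.abs_coord_sub_le {x y : Space G} {L : ℝ≥0} (h : IsString x y L)
    (w : V ⊕ Pentagon G) : |x.1 w - y.1 w| ≤ 20 * L := by
  induction h with
  | nil x => simp
  | @cons C x y z L hx hy _ ih =>
    have := C.abs_coord_sub_le hx hy w
    have h2 := abs_sub_le (x.1 w) (y.1 w) (z.1 w)
    push_cast
    linarith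

theorem edist_lt_iff {x y : Space G} {r : ℝ≥0∞} :
    edist x y < r ↔ ∃ L : ℝ≥0, IsString x y L ∧ (L : ℝ≥0∞) < r := by
  change (⨅ (L : ℝ≥0) (_ : IsString x y L), (L : ℝ≥0∞)) < r ↔ _
  simp only [iInf_lt_iff, exists_prop]

theorem Cell.edist_le (C : Cell G) {x y : Space G} (hx : C.Contains x) (hy : C.Contains y) :
    edist x y ≤ ENNReal.ofReal (dist (C.chart x) (C.chart y)) := by
  refine (iInf₂_le _ (IsString.cons C hx hy (IsString.nil y))).trans ?_
  rw [add_zero, ← edist_dist, edist_nndist]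

theorem abs_coord_sub_le_of_edist_le {x y : Space G} {r : ℝ} (hr : 0 ≤ r)
    (h : edist x y ≤ ENNReal.ofReal r) (w : V ⊕ Pentagon G) : |x.1 w - y.1 w| ≤ 20 * r := by
  refine le_of_forall_pos_le_add fun ε hε => ?_
  obtain ⟨L, hL, hLr⟩ := edist_lt_iff.1 (h.trans_lt
    ((ENNReal.ofReal_lt_ofReal_iff (by linarith)).2 (by linarith : r < r + ε / 20)))
  have h1 := hL.abs_coord_sub_le w
  have h2 : (L : ℝ) < r + ε / 20 := by
    rw [← ENNReal.ofReal_coe_nnreal] at hLr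
    exact (ENNReal.ofReal_lt_ofReal_iff (by linarith)).1 hLr
  linarith

theorem eq_of_edist_eq_zero {x y : Space G} (h : edist x y = 0) : x = y := by
  refine Subtype.ext (Finsupp.ext fun w => ?_)
  have := abs_coord_sub_le_of_edist_le le_rfl (by rw [h]; exact bot_le) w
  rw [mul_zero] at this
  exact sub_eq_zero.1 (abs_nonpos_iff.1 this)

/-- A string either stays in the open star of an edge `{v, a}`, and then it is at least as long as
the variation along it of any function that is Lipschitz on the cells there, or it is long. -/
theorem IsString.variation_le {v a : V ⊕ Pentagon G} {F : Space G → ℝ}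
    (hF : ∀ (C : Cell G) (x y : Space G), C.Contains x → C.Contains y → 0 < x.1 v → 0 < x.1 a →
      0 < y.1 v → 0 < y.1 a → |F x - F y| ≤ dist (C.chart x) (C.chart y))
    {x y : Space G} {L : ℝ≥0} (h : IsString x y L) :
    (0 < x.1 v → 0 < x.1 a → |F x - F y| ≤ L ∧ 0 < y.1 v ∧ 0 < y.1 a) ∨
      ∃ w, (w = v ∨ w = a) ∧ x.1 w + y.1 w ≤ 20 * L := by
  induction h with
  | nil x => exact Or.inl fun h1 h2 => ⟨by simp, h1, h2⟩
  | @cons C x y z L hx hy hyz ih =>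
    have hd : 0 ≤ dist (C.chart x) (C.chart y) := dist_nonneg
    have out : ∀ w, y.1 w ≤ 0 → x.1 w + z.1 w ≤
        20 * ((nndist (C.chart x) (C.chart y) + L : ℝ≥0) : ℝ) := by
      intro w hw
      have h1 := (le_abs_self _).trans (C.abs_coord_sub_le hx hy w)
      have h2 := (neg_abs_le _).trans' (neg_le_neg (hyz.abs_coord_sub_le w))
      push_cast
      linarith
    by_cases hyv : 0 < y.1 v
    · by_cases hya : 0 < y.1 a
      · rcases ih with ih | ⟨w, hw, hle⟩
        · refine Or.inl fun hxv hxa => ⟨?_, (ih hyv hya).2⟩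
          have h1 := hF C x y hx hy hxv hxa hyv hya
          have h2 := (ih hyv hya).1
          have h3 := abs_sub_le (F x) (F y) (F z)
          push_cast
          linarith
        · refine Or.inr ⟨w, hw, ?_⟩
          have h1 := (le_abs_self _).trans (C.abs_coord_sub_le hx hy w)
          push_cast
          linarith
      · exact Or.inr ⟨a, Or.inr rfl, out a (not_lt.1 hya)⟩
    · exact Or.inr ⟨v, Or.inl rfl, out v (not_lt.1 hyv)⟩

end Cells

/-! ### Unfolding the star of an edge -/

section Unfolding

variable {V : Type*} {G : SimpleGraph V}

/-- The length of the edge of the subdivision joining a vertex of `X` with the vertex `w`. -/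
def len (w : V ⊕ Pentagon G) : ℝ := if w.isLeft then 1 else circumradius 5

/-- The length of an edge of the subdivision. -/
def edgeLen (w w' : V ⊕ Pentagon G) : ℝ := if w.isLeft ∧ w'.isLeft then 1 else circumradius 5

/-- The angle between two edges of a triangle of the subdivision issuing from a vertex of `X`. -/
def ang (a b : V ⊕ Pentagon G) : ℝ :=
  if a.isLeft ∧ b.isLeft then Real.pi / 3 else 3 * Real.pi / 10

theorem len_pos (w : V ⊕ Pentagon G) : 0 < len w := by
  unfold len
  split_ifs
  exacts [one_pos, circumradius_pos (by norm_num)]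

theorem half_le_len (w : V ⊕ Pentagon G) : 1 / 2 ≤ len w := by
  unfold len
  split_ifs
  exacts [by norm_num, half_le_circumradius (by norm_num)]

theorem ang_comm (a b : V ⊕ Pentagon G) : ang a b = ang b a := by
  simp only [ang, and_comm]

theorem ang_le (a b : V ⊕ Pentagon G) : ang a b ≤ Real.pi / 3 := by
  unfold ang
  split_ifs <;> linarith [Real.pi_pos]

theorem le_ang (a b : V ⊕ Pentagon G) : 3 * Real.pi / 10 ≤ ang a b := by
  unfold ang
  split_ifs <;> linarith [Real.pi_pos]

theorem ang_pos (a b : V ⊕ Pentagon G) : 0 < ang a b := by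
  linarith [le_ang a b, Real.pi_pos]

theorem half_le_sin_ang (a b : V ⊕ Pentagon G) : 1 / 2 ≤ Real.sin (ang a b) := by
  rw [← Real.sin_pi_div_six]
  apply Real.sin_le_sin_of_le_of_le_pi_div_two <;>
    linarith [le_ang a b, ang_le a b, Real.pi_pos]

theorem sin_ang_pos (a b : V ⊕ Pentagon G) : 0 < Real.sin (ang a b) := by
  linarith [half_le_sin_ang a b]

theorem two_mul_circumradius_five_mul_cos : 2 * circumradius 5 * Real.cos (3 * Real.pi / 10) = 1 := by
  have h : (0 : ℝ) < Real.sin (Real.pi / 5) := by simpa using sin_pi_div_pos (n := 5) (by norm_num)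
  rw [show 3 * Real.pi / 10 = Real.pi / 2 - Real.pi / 5 by ring, Real.cos_pi_div_two_sub,
    circumradius]
  push_cast
  field_simp

theorem edgeLen_sq {a b : V ⊕ Pentagon G} (h : a.isLeft ∨ b.isLeft) :
    edgeLen a b ^ 2 = len a ^ 2 + len b ^ 2 - 2 * len a * len b * Real.cos (ang a b) := by
  have := two_mul_circumradius_five_mul_cos
  rcases a with a | a <;> rcases b with b | b <;> simp [edgeLen, len, ang] at h ⊢ <;> linarith

theorem norm_ofReal_sub_mul_exp (r s θ : ℝ) :
    ‖(r : ℂ) - s * Complex.exp (θ * Complex.I)‖ ^ 2 = r ^ 2 + s ^ 2 - 2 * r * s * Real.cos θ := by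
  rw [← Complex.normSq_eq_norm_sq, Complex.normSq_apply, Complex.sub_re, Complex.sub_im,
    Complex.re_ofReal_mul, Complex.im_ofReal_mul, Complex.exp_ofReal_mul_I_re,
    Complex.exp_ofReal_mul_I_im, Complex.ofReal_re, Complex.ofReal_im]
  linear_combination s ^ 2 * Real.sin_sq_add_cos_sq θ

/-- The positions of the vertices when the star of the edge `{v, a}` is folded into the plane, with
`v` at the origin and `a` on the positive real axis; the sign `σ` tells on which side of the real
axis a vertex is placed. -/
def dev (v : V) (a : V ⊕ Pentagon G) (σ : V ⊕ Pentagon G → ℝ) (w : V ⊕ Pentagon G) : ℂ :=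
  open Classical in
  if w = Sum.inl v then 0 else if w = a then len a else
    len w * Complex.exp ((σ w * ang a w : ℝ) * Complex.I)

/-- The folding of the star of the edge `{v, a}` into the plane. -/
def develop (v : V) (a : V ⊕ Pentagon G) (σ : V ⊕ Pentagon G → ℝ) (x : Space G) : ℂ :=
  x.1.sum fun w t => t • dev v a σ w

theorem develop_eq (v : V) (a : V ⊕ Pentagon G) (σ : V ⊕ Pentagon G → ℝ) (x : Space G)
    {s : Finset (V ⊕ Pentagon G)} (h : x.1.support ⊆ s) :
    develop v a σ x = ∑ w ∈ s, x.1 w • dev v a σ w :=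
  Finsupp.sum_of_support_subset _ h _ fun _ _ => zero_smul _ _

variable {v : V} {a : V ⊕ Pentagon G} {σ : V ⊕ Pentagon G → ℝ}

theorem dev_self : dev v a σ (Sum.inl v) = 0 := by simp [dev]

theorem dev_axis (h : a ≠ Sum.inl v) : dev v a σ a = len a := by simp [dev, h]

theorem dev_of_ne {b : V ⊕ Pentagon G} (h : b ≠ Sum.inl v) (h' : b ≠ a) :
    dev v a σ b = len b * Complex.exp ((σ b * ang a b : ℝ) * Complex.I) := by simp [dev, h, h']

theorem norm_dev {b : V ⊕ Pentagon G} (h : b ≠ Sum.inl v) : ‖dev v a σ b‖ = len b := by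
  by_cases hb : b = a
  · subst hb
    rw [dev_axis h, Complex.norm_real, Real.norm_of_nonneg (len_pos _).le]
  · rw [dev_of_ne h hb, norm_mul, Complex.norm_exp_ofReal_mul_I, mul_one, Complex.norm_real,
      Real.norm_of_nonneg (len_pos _).le]

theorem edgeLen_pos (w w' : V ⊕ Pentagon G) : 0 < edgeLen w w' := by
  unfold edgeLen
  split_ifs
  exacts [one_pos, circumradius_pos (by norm_num)]

theorem edgeLen_inl (b : V ⊕ Pentagon G) : edgeLen (Sum.inl v) b = len b := by
  simp [edgeLen, len]

theorem dist_dev_axis (hσ : ∀ w, σ w = 1 ∨ σ w = -1) {b : V ⊕ Pentagon G} (ha : a ≠ Sum.inl v)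
    (hb : b ≠ Sum.inl v) (hba : b ≠ a) (h : a.isLeft ∨ b.isLeft) :
    dist (dev v a σ a) (dev v a σ b) = edgeLen a b := by
  rw [← sq_eq_sq₀ dist_nonneg (edgeLen_pos _ _).le, edgeLen_sq h, dev_axis ha, dev_of_ne hb hba,
    Complex.dist_eq, norm_ofReal_sub_mul_exp]
  rcases hσ b with h | h <;> simp [h]

theorem dist_dev_of_pentagon {P : Pentagon G} (hσ : ∀ w, σ w = 1 ∨ σ w = -1) {b b' : V}
    (hb : b ≠ v) (hb' : b' ≠ v) (h : σ (Sum.inl b) = -σ (Sum.inl b')) :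
    dist (dev v (Sum.inr P) σ (Sum.inl b)) (dev v (Sum.inr P) σ (Sum.inl b')) =
      2 * Real.cos (Real.pi / 5) := by
  rw [dev_of_ne (by simpa using hb) (by simp), dev_of_ne (by simpa using hb') (by simp),
    Complex.dist_eq, h]
  have hc : 0 < Real.cos (Real.pi / 5) :=
    Real.cos_pos_of_mem_Ioo ⟨by linarith [Real.pi_pos], by linarith [Real.pi_pos]⟩
  have key : ‖Complex.exp ((-(3 * Real.pi / 10) : ℝ) * Complex.I) -
      Complex.exp ((3 * Real.pi / 10 : ℝ) * Complex.I)‖ = 2 * Real.cos (Real.pi / 5) := by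
    rw [← sq_eq_sq₀ (norm_nonneg _) (by positivity), ← Complex.normSq_eq_norm_sq,
      Complex.normSq_apply, Complex.sub_re, Complex.sub_im, Complex.exp_ofReal_mul_I_re,
      Complex.exp_ofReal_mul_I_im, Complex.exp_ofReal_mul_I_re, Complex.exp_ofReal_mul_I_im,
      Real.cos_neg, Real.sin_neg, show 3 * Real.pi / 10 = Real.pi / 2 - Real.pi / 5 by ring,
      Real.sin_pi_div_two_sub]
    ring
  rcases hσ (Sum.inl b') with h' | h'
  · simpa [len, ang, h'] using key
  · rw [← key, norm_sub_rev]
    simp [len, ang, h']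

theorem dist_sum_eq_dist_sum {ι : Type*} {s : Finset ι} {f g : ι → ℝ} (hf : ∑ i ∈ s, f i = 1)
    (hg : ∑ i ∈ s, g i = 1) {p q : ι → ℂ}
    (h : ∀ i ∈ s, ∀ j ∈ s, dist (p i) (p j) = dist (q i) (q j)) :
    dist (∑ i ∈ s, f i • p i) (∑ i ∈ s, g i • p i) =
      dist (∑ i ∈ s, f i • q i) (∑ i ∈ s, g i • q i) := by
  have key := fun r : ι → ℂ => EuclideanGeometry.dist_affineCombination r hf hg
  dsimp only at key
  simp only [s.affineCombination_eq_linear_combination _ _ hf,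
    s.affineCombination_eq_linear_combination _ _ hg] at key
  rw [← mul_self_inj dist_nonneg dist_nonneg, key, key]
  congr 2
  exact Finset.sum_congr rfl fun i hi => Finset.sum_congr rfl fun j hj => by rw [h i hi j hj]

/-- The vertex `w` of the subdivision lies in the cell `C`. -/
def Cell.Mem (C : Cell G) (w : V ⊕ Pentagon G) : Prop :=
  (∃ i, w = Sum.inl (C.vertex i)) ∨ ∃ P : Pentagon G, P.1 = Set.range C.vertex ∧ w = Sum.inr P

theorem Cell.dist_corner (C : Cell G) {i j : Fin C.n} (h : (SimpleGraph.cycleGraph C.n).Adj i j) :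
    dist (corner C.n i) (corner C.n j) = 1 := by
  rcases C with ⟨n, hn | hn | hn, φ⟩ <;> subst hn
  · exact dist_corner_of_adj (n := 0) h
  · exact dist_corner_of_adj (n := 1) h
  · exact dist_corner_of_adj (n := 3) h

theorem Cell.dist_pos_of_mem_face {C : Cell G} {w w' : V ⊕ Pentagon G} (hw : C.Mem w)
    (hw' : C.Mem w') (hne : w ≠ w') {s : Finset (V ⊕ Pentagon G)} (hs : s ∈ (subdivision G).faces)
    (hws : w ∈ s) (hws' : w' ∈ s) : dist (C.pos w) (C.pos w') = edgeLen w w' := by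
  rcases hw with ⟨i, rfl⟩ | ⟨P, hP, rfl⟩ <;> rcases hw' with ⟨j, rfl⟩ | ⟨Q, hQ, rfl⟩
  · rw [C.pos_inl, C.pos_inl, C.dist_corner]
    · simp [edgeLen]
    · exact C.vertex.map_rel_iff.1 (adj_of_mem_face hs hws hws' fun h => hne (congrArg _ h))
  · rw [C.pos_inl, C.pos_inr, dist_zero_right, norm_corner _ C.two_le]
    simp [edgeLen, Cell.n_eq_five hQ]
  · rw [C.pos_inl, C.pos_inr, dist_zero_left, norm_corner _ C.two_le]
    simp [edgeLen, Cell.n_eq_five hP]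
  · exact absurd (congrArg Sum.inr (eq_of_mem_face hs hws hws')) hne

theorem not_triangle_of_pentagon (φ : SimpleGraph.cycleGraph 5 ↪g G) {i j k : Fin 5}
    (h₁ : G.Adj (φ i) (φ j)) (h₂ : G.Adj (φ i) (φ k)) (h₃ : G.Adj (φ j) (φ k)) : False := by
  rw [φ.map_rel_iff] at h₁ h₂ h₃
  revert i j k
  simp only [SimpleGraph.cycleGraph_adj]
  decide

theorem Cell.not_two_triangles (C : Cell G) {i j k l : Fin C.n} (h₁ : G.Adj (C.vertex i) (C.vertex j))
    (h₂ : G.Adj (C.vertex i) (C.vertex k)) (h₃ : G.Adj (C.vertex j) (C.vertex k))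
    (h₄ : G.Adj (C.vertex i) (C.vertex l)) (h₅ : G.Adj (C.vertex j) (C.vertex l)) (h : k ≠ l) :
    False := by
  have a₁ := h₁.ne
  have a₂ := h₂.ne
  have a₃ := h₃.ne
  have a₄ := h₄.ne
  have a₅ := h₅.ne
  rcases C with ⟨n, hn | hn | hn, φ⟩ <;> subst hn
  · dsimp only at *
    rw [φ.injective.ne_iff] at *
    omega
  · dsimp only at *
    rw [φ.injective.ne_iff] at *
    omega
  · exact not_triangle_of_pentagon φ h₁ h₂ h₃

/-- In the open star of an edge `{v, a}`, the metric of a cell is the metric of the plane into which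
this star is folded, provided that the two halves of a pentagon adjacent to a spoke `{v, a}` are
placed on different sides. -/
theorem Cell.dist_chart_eq (C : Cell G) (hσ : ∀ w, σ w = 1 ∨ σ w = -1) (ha : a ≠ Sum.inl v)
    (hσ' : ∀ P : Pentagon G, a = Sum.inr P → ∀ b b' : V, b ∈ P.1 → b' ∈ P.1 → G.Adj v b → G.Adj v b' →
      b ≠ b' → σ (Sum.inl b) = -σ (Sum.inl b')) {x y : Space G} (hx : C.Contains x)
    (hy : C.Contains y) (hxv : 0 < x.1 (Sum.inl v)) (hxa : 0 < x.1 a) (hyv : 0 < y.1 (Sum.inl v))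
    (hya : 0 < y.1 a) :
    dist (C.chart x) (C.chart y) = dist (develop v a σ x) (develop v a σ y) := by
  classical
  have sx : x.1.support ⊆ x.1.support ∪ y.1.support := Finset.subset_union_left
  have sy : y.1.support ⊆ x.1.support ∪ y.1.support := Finset.subset_union_right
  rw [C.chart_eq x sx, C.chart_eq y sy, develop_eq v a σ x sx, develop_eq v a σ y sy]
  refine dist_sum_eq_dist_sum (sum_coord x sx) (sum_coord y sy) ?_
  have hmem : ∀ w ∈ x.1.support ∪ y.1.support, C.Mem w ∧ ∃ s ∈ (subdivision G).faces,
      Sum.inl v ∈ s ∧ a ∈ s ∧ w ∈ s := by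
    intro w hw
    rcases Finset.mem_union.1 hw with hw | hw
    · exact ⟨hx w hw, _, x.2.1, Finsupp.mem_support_iff.2 hxv.ne', Finsupp.mem_support_iff.2 hxa.ne',
        hw⟩
    · exact ⟨hy w hw, _, y.2.1, Finsupp.mem_support_iff.2 hyv.ne', Finsupp.mem_support_iff.2 hya.ne',
        hw⟩
  have hvC : C.Mem (Sum.inl v) := hx _ (Finsupp.mem_support_iff.2 hxv.ne')
  have haC : C.Mem a := hx _ (Finsupp.mem_support_iff.2 hxa.ne')
  have hleft : ∀ w ∈ x.1.support ∪ y.1.support, w ≠ a → a.isLeft ∨ w.isLeft := by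
    intro w hw hwa
    obtain ⟨-, s, hs, -, has, hws⟩ := hmem w hw
    rcases a with a | P
    · simp
    rcases w with w | Q
    · simp
    · exact absurd (congrArg Sum.inr (eq_of_mem_face hs hws has)) hwa
  -- the distances from `v`
  have h₀ : ∀ w ∈ x.1.support ∪ y.1.support,
      dist (C.pos (Sum.inl v)) (C.pos w) = dist (dev v a σ (Sum.inl v)) (dev v a σ w) := by
    intro w hw
    by_cases hwv : w = Sum.inl v
    · rw [hwv, dist_self, dist_self]
    obtain ⟨hwC, s, hs, hvs, has, hws⟩ := hmem w hw
    rw [Cell.dist_pos_of_mem_face hvC hwC (Ne.symm hwv) hs hvs hws, edgeLen_inl, dev_self,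
      dist_zero_left, norm_dev hwv]
  -- the distances from `a`
  have h₁ : ∀ w ∈ x.1.support ∪ y.1.support,
      dist (C.pos a) (C.pos w) = dist (dev v a σ a) (dev v a σ w) := by
    intro w hw
    by_cases hwa : w = a
    · rw [hwa, dist_self, dist_self]
    by_cases hwv : w = Sum.inl v
    · rw [hwv, dist_comm, dist_comm (dev v a σ a)]
      exact h₀ a (sx (Finsupp.mem_support_iff.2 hxa.ne'))
    obtain ⟨hwC, s, hs, hvs, has, hws⟩ := hmem w hw
    rw [Cell.dist_pos_of_mem_face haC hwC (Ne.symm hwa) hs has hws,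
      dist_dev_axis hσ ha hwv hwa (hleft w hw hwa)]
  intro b hb b' hb'
  by_cases hbb : b = b'
  · rw [hbb, dist_self, dist_self]
  by_cases hbv : b = Sum.inl v
  · rw [hbv]; exact h₀ b' hb'
  by_cases hba : b = a
  · rw [hba]; exact h₁ b' hb'
  by_cases hbv' : b' = Sum.inl v
  · rw [hbv', dist_comm, dist_comm (dev v a σ b)]; exact h₀ b hb
  by_cases hba' : b' = a
  · rw [hba', dist_comm, dist_comm (dev v a σ b)]; exact h₁ b hb
  obtain ⟨hbC, s, hs, hvs, has, hbs⟩ := hmem b hb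
  obtain ⟨hbC', s', hs', hvs', has', hbs'⟩ := hmem b' hb'
  obtain ⟨i, hi⟩ | ⟨P, -, hP⟩ := hvC
  swap
  · cases hP
  obtain rfl := Sum.inl.inj hi
  rcases haC with ⟨j, rfl⟩ | ⟨P, hP, rfl⟩
  · exfalso
    have hij := adj_of_mem_face hs hvs has (fun h => ha (congrArg _ h).symm)
    rcases hbC with ⟨k, rfl⟩ | ⟨Q, hQ, rfl⟩
    · have hik := adj_of_mem_face hs hvs hbs (fun h => hbv (congrArg _ h).symm)
      have hjk := adj_of_mem_face hs has hbs (fun h => hba (congrArg _ h).symm)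
      rcases hbC' with ⟨l, rfl⟩ | ⟨Q, hQ, rfl⟩
      · have hil := adj_of_mem_face hs' hvs' hbs' (fun h => hbv' (congrArg _ h).symm)
        have hjl := adj_of_mem_face hs' has' hbs' (fun h => hba' (congrArg _ h).symm)
        exact C.not_two_triangles hij hik hjk hil hjl (fun h => hbb (by rw [h]))
      · have h5 := Cell.n_eq_five hQ
        clear hx hy hmem hleft h₀ h₁
        rcases C with ⟨n, hn, φ⟩
        dsimp only at h5
        subst h5
        exact not_triangle_of_pentagon φ hij hik hjk
    · rcases hbC' with ⟨l, rfl⟩ | ⟨R, hR, rfl⟩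
      · have hil := adj_of_mem_face hs' hvs' hbs' (fun h => hbv' (congrArg _ h).symm)
        have hjl := adj_of_mem_face hs' has' hbs' (fun h => hba' (congrArg _ h).symm)
        have h5 := Cell.n_eq_five hQ
        clear hx hy hmem hleft h₀ h₁
        rcases C with ⟨n, hn, φ⟩
        dsimp only at h5
        subst h5
        exact not_triangle_of_pentagon φ hij hil hjl
      · exact hbb (congrArg _ (Subtype.ext (hQ.trans hR.symm)))
  · rcases hbC with ⟨k, rfl⟩ | ⟨Q, hQ, rfl⟩
    swap
    · exact absurd (congrArg _ (eq_of_mem_face hs hbs has)) hba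
    rcases hbC' with ⟨l, rfl⟩ | ⟨Q, hQ, rfl⟩
    swap
    · exact absurd (congrArg _ (eq_of_mem_face hs' hbs' has')) hba'
    have hik := adj_of_mem_face hs hvs hbs (fun h => hbv (congrArg _ h).symm)
    have hil := adj_of_mem_face hs' hvs' hbs' (fun h => hbv' (congrArg _ h).symm)
    have hkl : C.vertex k ≠ C.vertex l := fun h => hbb (congrArg _ h)
    rw [C.pos_inl, C.pos_inl, dist_dev_of_pentagon hσ hik.ne' hil.ne'
      (hσ' P rfl _ _ (hP ▸ ⟨k, rfl⟩) (hP ▸ ⟨l, rfl⟩) hik hil hkl)]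
    have h5 := Cell.n_eq_five hP
    clear hx hy hmem hleft h₀ h₁
    rcases C with ⟨n, hn, φ⟩
    dsimp only at h5
    subst h5
    exact dist_corner_of_adj_of_adj (φ.map_rel_iff.1 hik) (φ.map_rel_iff.1 hil)
      (fun h => hkl (by rw [h]))

end Unfolding

/-! ### Straight paths around a vertex -/

section Sectors

variable {V : Type*} {G : SimpleGraph V}

/-- Barycentric coordinates in a triangle `{v, b, c}`. -/
def sectorFun (v : V) (b c : V ⊕ Pentagon G) (s t : ℝ) : V ⊕ Pentagon G →₀ ℝ :=
  Finsupp.single (Sum.inl v) (1 - s - t) + Finsupp.single b s + Finsupp.single c t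

/-- A path in the link of `v` whose consecutive edges are different. -/
structure IsLinkPath (v : V) (a : ℕ → V ⊕ Pentagon G) : Prop where
  face : ∀ i, ∃ s ∈ (subdivision G).faces, Sum.inl v ∈ s ∧ a i ∈ s ∧ a (i + 1) ∈ s
  ne_apex : ∀ i, a i ≠ Sum.inl v
  ne_succ : ∀ i, a i ≠ a (i + 1)
  ne_add_two : ∀ i, a i ≠ a (i + 2)

/-- The angle turned by the first `i` edges of a path in the link of a vertex. -/
def theta (a : ℕ → V ⊕ Pentagon G) (i : ℕ) : ℝ := ∑ j ∈ Finset.range i, ang (a j) (a (j + 1))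

/-- The point `x` has polar coordinates `(r, θ)` around `v` and lies in the sector
`{v, a i, a (i + 1)}`. -/
def AtPolar (v : V) (a : ℕ → V ⊕ Pentagon G) (x : Space G) (r θ : ℝ) (i : ℕ) : Prop :=
  x.1 = sectorFun v (a i) (a (i + 1))
    (r * Real.sin (theta a (i + 1) - θ) / (len (a i) * Real.sin (ang (a i) (a (i + 1)))))
    (r * Real.sin (θ - theta a i) / (len (a (i + 1)) * Real.sin (ang (a i) (a (i + 1)))))

variable {v : V} {a : ℕ → V ⊕ Pentagon G}

theorem theta_succ (i : ℕ) : theta a (i + 1) = theta a i + ang (a i) (a (i + 1)) :=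
  Finset.sum_range_succ _ _

theorem theta_zero : theta a 0 = 0 := rfl

theorem theta_strictMono : StrictMono (theta a) :=
  strictMono_nat_of_lt_succ fun i => by rw [theta_succ]; linarith [ang_pos (a i) (a (i + 1))]

theorem exists_sector {θ : ℝ} (hθ : 0 ≤ θ) : ∃ i, theta a i ≤ θ ∧ θ < theta a (i + 1) := by
  have hlarge : ∀ k : ℕ, (k : ℝ) * (3 * Real.pi / 10) ≤ theta a k := by
    intro k
    induction k with
    | zero => simp [theta_zero]
    | succ k ih => rw [theta_succ]; push_cast; linarith [le_ang (a k) (a (k + 1))]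
  have hex : ∃ k, θ < theta a k := by
    obtain ⟨k, hk⟩ := exists_nat_gt (θ / (3 * Real.pi / 10))
    rw [div_lt_iff₀ (by positivity)] at hk
    exact ⟨k, hk.trans_le (hlarge k)⟩
  classical
  obtain ⟨i, hi⟩ : ∃ i, Nat.find hex = i + 1 := by
    refine Nat.exists_eq_succ_of_ne_zero fun h => ?_
    have := Nat.find_spec hex
    rw [h, theta_zero] at this
    linarith
  refine ⟨i, not_lt.1 (Nat.find_min hex (m := i) (by omega)), ?_⟩
  rw [← hi]
  exact Nat.find_spec hex

theorem sector_unique {θ : ℝ} {i j : ℕ} (hi : theta a i ≤ θ) (hi' : θ < theta a (i + 1))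
    (hj : theta a j ≤ θ) (hj' : θ < theta a (j + 1)) : i = j := by
  have h1 := theta_strictMono.lt_iff_lt.1 (hi.trans_lt hj')
  have h2 := theta_strictMono.lt_iff_lt.1 (hj.trans_lt hi')
  omega

theorem exists_point (h : IsLinkPath v a) (i : ℕ) {s t : ℝ} (hs : 0 ≤ s) (ht : 0 ≤ t)
    (hst : s + t ≤ 1) : ∃ x : Space G, x.1 = sectorFun v (a i) (a (i + 1)) s t := by
  classical
  obtain ⟨f, hf, hvf, haf, haf'⟩ := h.face i
  have hsub : (sectorFun v (a i) (a (i + 1)) s t).support ⊆ f := by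
    intro w hw
    by_contra hwf
    rw [Finsupp.mem_support_iff] at hw
    refine hw ?_
    have e : ∀ u ∈ f, u ≠ w := fun u hu h => hwf (h ▸ hu)
    simp [sectorFun, e _ hvf, e _ haf, e _ haf']
  have hsum : ((sectorFun v (a i) (a (i + 1)) s t).sum fun _ x => x) = 1 := by
    rw [sectorFun, Finsupp.sum_add_index' (fun _ => rfl) (fun _ _ _ => rfl),
      Finsupp.sum_add_index' (fun _ => rfl) (fun _ _ _ => rfl), Finsupp.sum_single_index rfl,
      Finsupp.sum_single_index rfl, Finsupp.sum_single_index rfl]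
    ring
  refine ⟨⟨_, mem_faces_of_subset hf hsub ?_, fun w => ?_, hsum⟩, rfl⟩
  · rw [Finset.nonempty_iff_ne_empty]
    intro h0
    rw [Finsupp.sum, h0, Finset.sum_empty] at hsum
    exact zero_ne_one hsum
  · simp only [sectorFun, Finsupp.add_apply, Finsupp.single_apply]
    split_ifs <;> linarith

theorem IsLinkPath.sectorFun_apply_apex (h : IsLinkPath v a) (i : ℕ) (s t : ℝ) :
    sectorFun v (a i) (a (i + 1)) s t (Sum.inl v) = 1 - s - t := by
  simp [sectorFun, h.ne_apex]

theorem IsLinkPath.sectorFun_apply_left (h : IsLinkPath v a) (i : ℕ) (s t : ℝ) :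
    sectorFun v (a i) (a (i + 1)) s t (a i) = s := by
  simp [sectorFun, (h.ne_apex _).symm, (h.ne_succ _).symm]

theorem IsLinkPath.sectorFun_apply_right (h : IsLinkPath v a) (i : ℕ) (s t : ℝ) :
    sectorFun v (a i) (a (i + 1)) s t (a (i + 1)) = t := by
  simp [sectorFun, (h.ne_apex _).symm, h.ne_succ]

theorem polar_coeff_bounds {r φ : ℝ} (hr : 0 ≤ r) (hr' : r ≤ 1 / 10) (hφ : 0 ≤ φ)
    {b c w : V ⊕ Pentagon G} (hφ' : φ ≤ ang b c) :
    0 ≤ r * Real.sin φ / (len w * Real.sin (ang b c)) ∧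
      r * Real.sin φ / (len w * Real.sin (ang b c)) ≤ 4 / 10 := by
  have h1 := half_le_len w
  have h2 := half_le_sin_ang b c
  have h3 : 0 ≤ Real.sin φ :=
    Real.sin_nonneg_of_nonneg_of_le_pi hφ (by linarith [ang_le b c, Real.pi_pos])
  have h4 := Real.sin_le_one φ
  have h5 : 1 / 4 ≤ len w * Real.sin (ang b c) := by nlinarith
  constructor
  · positivity
  · rw [div_le_iff₀ (by linarith)]
    nlinarith

theorem exists_atPolar (h : IsLinkPath v a) {r θ : ℝ} (hr : 0 ≤ r) (hr' : r ≤ 1 / 10) {i : ℕ}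
    (hi : theta a i ≤ θ) (hi' : θ ≤ theta a (i + 1)) : ∃ x, AtPolar v a x r θ i := by
  have hs := theta_succ (a := a) i
  obtain ⟨h1, h2⟩ := polar_coeff_bounds (b := a i) (c := a (i + 1)) (w := a i) hr hr'
    (by linarith : 0 ≤ theta a (i + 1) - θ) (by linarith)
  obtain ⟨h3, h4⟩ := polar_coeff_bounds (b := a i) (c := a (i + 1)) (w := a (i + 1)) hr hr'
    (by linarith : 0 ≤ θ - theta a i) (by linarith)
  exact exists_point h i h1 h3 (by linarith)

theorem AtPolar.apex_pos (h : IsLinkPath v a) {x : Space G} {r θ : ℝ} {i : ℕ}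
    (hx : AtPolar v a x r θ i) (hr : 0 ≤ r) (hr' : r ≤ 1 / 10)
    (hi : theta a i ≤ θ) (hi' : θ ≤ theta a (i + 1)) : 0 < x.1 (Sum.inl v) := by
  have hs := theta_succ (a := a) i
  obtain ⟨h1, h2⟩ := polar_coeff_bounds (b := a i) (c := a (i + 1)) (w := a i) hr hr'
    (by linarith : 0 ≤ theta a (i + 1) - θ) (by linarith)
  obtain ⟨h3, h4⟩ := polar_coeff_bounds (b := a i) (c := a (i + 1)) (w := a (i + 1)) hr hr'
    (by linarith : 0 ≤ θ - theta a i) (by linarith)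
  rw [hx, h.sectorFun_apply_apex]
  linarith

theorem AtPolar.left_pos (h : IsLinkPath v a) {x : Space G} {r θ : ℝ} {i : ℕ}
    (hx : AtPolar v a x r θ i) (hr : 0 < r) (hi : theta a i ≤ θ) (hi' : θ < theta a (i + 1)) :
    0 < x.1 (a i) := by
  have hs := theta_succ (a := a) i
  have h1 := len_pos (a i)
  have h2 := sin_ang_pos (a i) (a (i + 1))
  have h3 : 0 < Real.sin (theta a (i + 1) - θ) := Real.sin_pos_of_pos_of_lt_pi (by linarith)
    (by linarith [ang_le (a i) (a (i + 1)), Real.pi_pos])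
  rw [hx, h.sectorFun_apply_left]
  positivity

theorem AtPolar.right_pos (h : IsLinkPath v a) {x : Space G} {r θ : ℝ} {i : ℕ}
    (hx : AtPolar v a x r θ i) (hr : 0 < r) (hi : theta a i < θ) (hi' : θ ≤ theta a (i + 1)) :
    0 < x.1 (a (i + 1)) := by
  have hs := theta_succ (a := a) i
  have h1 := len_pos (a (i + 1))
  have h2 := sin_ang_pos (a i) (a (i + 1))
  have h3 : 0 < Real.sin (θ - theta a i) := Real.sin_pos_of_pos_of_lt_pi (by linarith)
    (by linarith [ang_le (a i) (a (i + 1)), Real.pi_pos])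
  rw [hx, h.sectorFun_apply_right]
  positivity

/-- A point on the common edge of two consecutive sectors. -/
theorem atPolar_succ_iff (x : Space G) (r : ℝ) (i : ℕ) :
    AtPolar v a x r (theta a (i + 1)) (i + 1) ↔ AtPolar v a x r (theta a (i + 1)) i := by
  have e1 : theta a (i + 1 + 1) - theta a (i + 1) = ang (a (i + 1)) (a (i + 1 + 1)) := by
    rw [theta_succ (i + 1)]; ring
  have e2 : theta a (i + 1) - theta a i = ang (a i) (a (i + 1)) := by rw [theta_succ]; ring
  have h1 := (sin_ang_pos (a i) (a (i + 1))).ne'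
  have h2 := (sin_ang_pos (a (i + 1)) (a (i + 1 + 1))).ne'
  rw [AtPolar, AtPolar, e1, e2, sub_self, Real.sin_zero, mul_zero, zero_div,
    zero_div, mul_div_mul_right _ _ h1, mul_div_mul_right _ _ h2]
  simp [sectorFun]

theorem polar_identity (r θ φ α : ℝ) (h : Real.sin α ≠ 0) :
    ((r * Real.sin (θ - φ) / Real.sin α : ℝ) : ℂ) +
      ((r * Real.sin (φ + α - θ) / Real.sin α : ℝ) : ℂ) * Complex.exp ((-1 * α : ℝ) * Complex.I) =
      r * Complex.exp ((θ - (φ + α) : ℝ) * Complex.I) := by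
  apply Complex.ext
  · rw [Complex.add_re, Complex.re_ofReal_mul, Complex.re_ofReal_mul, Complex.exp_ofReal_mul_I_re,
      Complex.exp_ofReal_mul_I_re, Complex.ofReal_re, neg_one_mul, Real.cos_neg,
      show θ - φ = (θ - (φ + α)) + α by ring, show φ + α - θ = -(θ - (φ + α)) by ring,
      Real.sin_neg, Real.sin_add]
    field_simp
    ring
  · rw [Complex.add_im, Complex.im_ofReal_mul, Complex.im_ofReal_mul, Complex.exp_ofReal_mul_I_im,
      Complex.exp_ofReal_mul_I_im, Complex.ofReal_im, neg_one_mul, Real.sin_neg,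
      show φ + α - θ = -(θ - (φ + α)) by ring, Real.sin_neg]
    field_simp
    ring

theorem polar_identity' (r θ φ α : ℝ) (h : Real.sin α ≠ 0) :
    ((r * Real.sin (φ + α - θ) / Real.sin α : ℝ) : ℂ) +
      ((r * Real.sin (θ - φ) / Real.sin α : ℝ) : ℂ) * Complex.exp ((1 * α : ℝ) * Complex.I) =
      r * Complex.exp ((θ - φ : ℝ) * Complex.I) := by
  apply Complex.ext
  · rw [Complex.add_re, Complex.re_ofReal_mul, Complex.re_ofReal_mul, Complex.exp_ofReal_mul_I_re,
      Complex.exp_ofReal_mul_I_re, Complex.ofReal_re, one_mul,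
      show φ + α - θ = α - (θ - φ) by ring, Real.sin_sub]
    field_simp
    ring
  · rw [Complex.add_im, Complex.im_ofReal_mul, Complex.im_ofReal_mul, Complex.exp_ofReal_mul_I_im,
      Complex.exp_ofReal_mul_I_im, Complex.ofReal_im, one_mul]
    field_simp
    ring

theorem develop_sectorFun {c b b' : V ⊕ Pentagon G} {σ : V ⊕ Pentagon G → ℝ} {s t : ℝ} {x : Space G}
    (hx : x.1 = sectorFun v b b' s t) :
    develop v c σ x = s • dev v c σ b + t • dev v c σ b' := by
  classical
  have h0 : ∀ w, (0 : ℝ) • dev v c σ w = 0 := fun _ => zero_smul _ _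
  have hadd : ∀ w (p q : ℝ), (p + q) • dev v c σ w = p • dev v c σ w + q • dev v c σ w :=
    fun _ _ _ => add_smul _ _ _
  rw [develop, hx, sectorFun, Finsupp.sum_add_index' (h := fun w t => t • dev v c σ w) h0 hadd,
    Finsupp.sum_add_index' (h := fun w t => t • dev v c σ w) h0 hadd,
    Finsupp.sum_single_index (h0 _), Finsupp.sum_single_index (h0 _),
    Finsupp.sum_single_index (h0 _), dev_self, smul_zero, zero_add]

theorem AtPolar.develop_right (h : IsLinkPath v a) {σ : V ⊕ Pentagon G → ℝ} {i : ℕ}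
    (hσ : σ (a i) = -1) {x : Space G} {r θ : ℝ} (hx : AtPolar v a x r θ i) :
    develop v (a (i + 1)) σ x = r * Complex.exp ((θ - theta a (i + 1) : ℝ) * Complex.I) := by
  rw [develop_sectorFun hx, dev_axis (h.ne_apex _), dev_of_ne (h.ne_apex _) (h.ne_succ _), hσ,
    ang_comm (a (i + 1)), theta_succ, ← polar_identity _ _ _ _ (sin_ang_pos (a i) (a (i + 1))).ne',
    Complex.real_smul, Complex.real_smul, ← mul_assoc, ← Complex.ofReal_mul, ← Complex.ofReal_mul,
    add_comm]
  have h1 := (len_pos (a i)).ne'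
  have h2 := (len_pos (a (i + 1))).ne'
  have h3 := (sin_ang_pos (a i) (a (i + 1))).ne'
  congr 2
  · field_simp
  · congr 1
    field_simp

theorem AtPolar.develop_left (h : IsLinkPath v a) {σ : V ⊕ Pentagon G → ℝ} {i : ℕ}
    (hσ : σ (a (i + 1)) = 1) {x : Space G} {r θ : ℝ} (hx : AtPolar v a x r θ i) :
    develop v (a i) σ x = r * Complex.exp ((θ - theta a i : ℝ) * Complex.I) := by
  rw [develop_sectorFun hx, dev_axis (h.ne_apex _), dev_of_ne (h.ne_apex _) (h.ne_succ _).symm, hσ,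
    theta_succ, ← polar_identity' _ _ _ _ (sin_ang_pos (a i) (a (i + 1))).ne',
    Complex.real_smul, Complex.real_smul, ← mul_assoc, ← Complex.ofReal_mul, ← Complex.ofReal_mul]
  have h1 := (len_pos (a i)).ne'
  have h2 := (len_pos (a (i + 1))).ne'
  have h3 := (sin_ang_pos (a i) (a (i + 1))).ne'
  congr 2
  · field_simp
  · congr 1
    field_simp

theorem support_sectorFun_subset (b c : V ⊕ Pentagon G) (s t : ℝ) {w : V ⊕ Pentagon G}
    (hw : w ∈ (sectorFun v b c s t).support) : w = Sum.inl v ∨ w = b ∨ w = c := by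
  classical
  by_contra! hne
  rw [Finsupp.mem_support_iff] at hw
  exact hw (by simp [sectorFun, hne.1.symm, hne.2.1.symm, hne.2.2.symm])

/-- Every triangle of the subdivision lies in a cell. -/
theorem exists_cell {s : Finset (V ⊕ Pentagon G)} (hs : s ∈ (subdivision G).faces)
    {b c : V ⊕ Pentagon G} (hv : Sum.inl v ∈ s) (hb : b ∈ s) (hc : c ∈ s) (hbv : b ≠ Sum.inl v)
    (hcv : c ≠ Sum.inl v) (hbc : b ≠ c) :
    ∃ C : Cell G, C.Mem (Sum.inl v) ∧ C.Mem b ∧ C.Mem c := by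
  have pent : ∀ (P : Pentagon G) (u : V), Sum.inr P ∈ s → Sum.inl u ∈ s →
      ∃ C : Cell G, C.Mem (Sum.inl v) ∧ C.Mem (Sum.inr P) ∧ C.Mem (Sum.inl u) := by
    intro P u hP hu
    obtain ⟨φ, hφ⟩ := P.exists_embedding
    have mem : ∀ w, Sum.inl w ∈ s → (⟨5, by norm_num, φ⟩ : Cell G).Mem (Sum.inl w) := by
      intro w hw
      have := mem_of_mem_face hs hw hP
      rw [← hφ] at this
      obtain ⟨i, rfl⟩ := this
      exact Or.inl ⟨i, rfl⟩
    exact ⟨⟨5, by norm_num, φ⟩, mem _ hv, Or.inr ⟨P, hφ.symm, rfl⟩, mem _ hu⟩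
  rcases b with b | P <;> rcases c with c | Q
  · have h1 := adj_of_mem_face hs hv hb (fun h => hbv (congrArg _ h).symm)
    have h2 := adj_of_mem_face hs hv hc (fun h => hcv (congrArg _ h).symm)
    have h3 := adj_of_mem_face hs hb hc (fun h => hbc (congrArg _ h))
    let φ : SimpleGraph.cycleGraph 3 ↪g G :=
      { toFun := ![v, b, c]
        inj' := by
          intro i j hij
          fin_cases i <;> fin_cases j <;> simp [h1.ne, h2.ne, h3.ne, h1.ne', h2.ne', h3.ne'] at hij ⊢
        map_rel_iff' := by
          intro i j
          change G.Adj (![v, b, c] i) (![v, b, c] j) ↔ _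
          rw [SimpleGraph.cycleGraph_three_eq_top]
          fin_cases i <;> fin_cases j <;> simp [h1, h2, h3, h1.symm, h2.symm, h3.symm] }
    exact ⟨⟨3, by norm_num, φ⟩, Or.inl ⟨(0 : Fin 3), rfl⟩, Or.inl ⟨(1 : Fin 3), rfl⟩,
      Or.inl ⟨(2 : Fin 3), rfl⟩⟩
  · obtain ⟨C, h1, h2, h3⟩ := pent Q b hc hb
    exact ⟨C, h1, h3, h2⟩
  · exact pent P c hb hc
  · exact absurd (congrArg _ (eq_of_mem_face hs hb hc)) hbc

theorem IsLinkPath.exists_cell_contains (h : IsLinkPath v a) (i : ℕ) : ∃ C : Cell G,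
    ∀ (x : Space G) (r θ : ℝ), AtPolar v a x r θ i → C.Contains x := by
  obtain ⟨s, hs, hvs, has, has'⟩ := h.face i
  obtain ⟨C, h1, h2, h3⟩ := exists_cell hs hvs has has' (h.ne_apex i) (h.ne_apex _) (h.ne_succ i)
  refine ⟨C, fun x r θ hx w hw => ?_⟩
  rw [hx] at hw
  rcases support_sectorFun_subset _ _ _ _ hw with rfl | rfl | rfl
  exacts [h1, h2, h3]

/-- The side of the edge `{v, a (i + 1)}` on which a vertex lies: the vertex `a i` lies on the
negative side. -/
def sideOf (b : V ⊕ Pentagon G) (w : V ⊕ Pentagon G) : ℝ :=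
  open Classical in if w = b then -1 else 1

theorem sideOf_eq (b w : V ⊕ Pentagon G) : sideOf b w = 1 ∨ sideOf b w = -1 := by
  unfold sideOf
  split_ifs <;> simp

theorem Pentagon.eq_or_eq_of_adj {P : Pentagon G} {v b b' t t' : V} (hv : v ∈ P.1) (hb : b ∈ P.1)
    (hb' : b' ∈ P.1) (ht : t ∈ P.1) (ht' : t' ∈ P.1) (h₁ : G.Adj v b) (h₂ : G.Adj v b')
    (h₃ : G.Adj v t) (h₄ : G.Adj v t') (hbb : b ≠ b') (htt : t ≠ t') :
    (b = t ∧ b' = t') ∨ (b = t' ∧ b' = t) := by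
  obtain ⟨φ, hφ⟩ := P.exists_embedding
  rw [← hφ] at hv hb hb' ht ht'
  obtain ⟨i, rfl⟩ := hv
  obtain ⟨j, rfl⟩ := hb
  obtain ⟨k, rfl⟩ := hb'
  obtain ⟨l, rfl⟩ := ht
  obtain ⟨m, rfl⟩ := ht'
  rw [φ.injective.ne_iff] at hbb htt
  simp only [φ.injective.eq_iff]
  rw [φ.map_rel_iff] at h₁ h₂ h₃ h₄
  clear hφ
  revert i j k l m
  simp only [SimpleGraph.cycleGraph_adj]
  decide

theorem IsLinkPath.sideOf_eq_neg (h : IsLinkPath v a) (i : ℕ) (P : Pentagon G)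
    (hP : a (i + 1) = Sum.inr P) (b b' : V) (hb : b ∈ P.1) (hb' : b' ∈ P.1) (hvb : G.Adj v b)
    (hvb' : G.Adj v b') (hbb : b ≠ b') :
    sideOf (a i) (Sum.inl b) = -sideOf (a i) (Sum.inl b') := by
  have key : ∀ w : V ⊕ Pentagon G, w ≠ Sum.inl v → w ≠ a (i + 1) →
      (∃ s ∈ (subdivision G).faces, Sum.inl v ∈ s ∧ w ∈ s ∧ a (i + 1) ∈ s) →
      v ∈ P.1 ∧ ∃ t, w = Sum.inl t ∧ t ∈ P.1 ∧ G.Adj v t := by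
    rintro w hwv hwa ⟨s, hs, hvs, hws, has⟩
    rw [hP] at has hwa
    rcases w with t | Q
    · exact ⟨mem_of_mem_face hs hvs has, t, rfl, mem_of_mem_face hs hws has,
        adj_of_mem_face hs hvs hws fun h => hwv (congrArg _ h).symm⟩
    · exact absurd (congrArg _ (eq_of_mem_face hs hws has)) hwa
  obtain ⟨hv, t, ht, htP, hvt⟩ := key (a i) (h.ne_apex i) (h.ne_succ i) (h.face i)
  obtain ⟨-, t', ht', htP', hvt'⟩ := key (a (i + 2)) (h.ne_apex _) (h.ne_succ (i + 1)).symm (by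
    obtain ⟨s, hs, h1, h2, h3⟩ := h.face (i + 1)
    exact ⟨s, hs, h1, h3, h2⟩)
  have htt : t ≠ t' := fun e => h.ne_add_two i (by rw [ht, ht', e])
  rcases Pentagon.eq_or_eq_of_adj hv hb hb' htP htP' hvb hvb' hvt hvt' hbb htt with
    ⟨rfl, rfl⟩ | ⟨rfl, rfl⟩
  · simp [sideOf, ht, hbb.symm]
  · simp [sideOf, ht, hbb]

theorem IsLinkPath.dist_chart_eq (h : IsLinkPath v a) (i : ℕ) (C : Cell G) {x y : Space G}
    (hx : C.Contains x) (hy : C.Contains y) (hxv : 0 < x.1 (Sum.inl v)) (hxa : 0 < x.1 (a (i + 1)))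
    (hyv : 0 < y.1 (Sum.inl v)) (hya : 0 < y.1 (a (i + 1))) :
    dist (C.chart x) (C.chart y) = dist (develop v (a (i + 1)) (sideOf (a i)) x)
      (develop v (a (i + 1)) (sideOf (a i)) y) :=
  C.dist_chart_eq (sideOf_eq _) (h.ne_apex _) (h.sideOf_eq_neg i) hx hy hxv hxa hyv hya

end Sectors

section Loops

variable {V : Type*} {G : SimpleGraph V} {v : V} {a : ℕ → V ⊕ Pentagon G}

theorem exists_polar_map (h : IsLinkPath v a) : ∃ Φ : ℝ → ℝ → Space G, ∀ r θ i, 0 ≤ r → r ≤ 1 / 10 →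
    theta a i ≤ θ → θ < theta a (i + 1) → AtPolar v a (Φ r θ) r θ i := by
  have key : ∀ r θ, ∃ x : Space G, ∀ i, 0 ≤ r → r ≤ 1 / 10 → theta a i ≤ θ → θ < theta a (i + 1) →
      AtPolar v a x r θ i := by
    intro r θ
    by_cases hex : ∃ i, 0 ≤ r ∧ r ≤ 1 / 10 ∧ theta a i ≤ θ ∧ θ < theta a (i + 1)
    · obtain ⟨i, h1, h2, h3, h4⟩ := hex
      obtain ⟨x, hx⟩ := exists_atPolar h h1 h2 h3 h4.le
      refine ⟨x, fun j _ _ h5 h6 => ?_⟩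
      rwa [sector_unique h5 h6 h3 h4]
    · obtain ⟨x, -⟩ := exists_point h 0 le_rfl le_rfl (by norm_num)
      exact ⟨x, fun i h1 h2 h3 h4 => absurd ⟨i, h1, h2, h3, h4⟩ hex⟩
  choose Φ hΦ using key
  exact ⟨Φ, fun r θ i h1 h2 h3 h4 => hΦ r θ i h1 h2 h3 h4⟩

theorem sqrt_mul_exp_arctan {d : ℝ} (hd : 0 < d) (u : ℝ) :
    (√(d ^ 2 + u ^ 2) : ℂ) * Complex.exp ((Real.arctan (u / d) : ℝ) * Complex.I) =
      d + u * Complex.I := by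
  have h1 : √(d ^ 2 + u ^ 2) = d * √(1 + (u / d) ^ 2) := by
    rw [← Real.sqrt_sq hd.le, ← Real.sqrt_mul (by positivity), Real.sqrt_sq hd.le]
    congr 1
    field_simp
  have h2 : 0 < √(1 + (u / d) ^ 2) := Real.sqrt_pos.2 (by positivity)
  apply Complex.ext
  · rw [Complex.re_ofReal_mul, Complex.exp_ofReal_mul_I_re, Real.cos_arctan, h1]
    simp
    field_simp
  · rw [Complex.im_ofReal_mul, Complex.exp_ofReal_mul_I_im, Real.sin_arctan, h1]
    simp
    field_simp

/-- The path that looks like a straight line at distance `d` from the origin in the development of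
the sectors around `v`. -/
def linePath (Φ : ℝ → ℝ → Space G) (d θ₀ T : ℝ) (s : ℝ) : Space G :=
  Φ √(d ^ 2 + (s - T) ^ 2) (θ₀ + Real.arctan ((s - T) / d))

theorem exists_crossing {d θ₀ T α s s' : ℝ} (h : s ≤ s')
    (hs : θ₀ + Real.arctan ((s - T) / d) ≤ α) (hs' : α ≤ θ₀ + Real.arctan ((s' - T) / d)) :
    ∃ t ∈ Set.Icc s s', θ₀ + Real.arctan ((t - T) / d) = α :=
  intermediate_value_Icc h (by fun_prop) ⟨hs, hs'⟩

theorem dist_line_points {d β : ℝ} (u u' : ℝ) :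
    dist (((d : ℂ) + u * Complex.I) * Complex.exp (β * Complex.I))
      (((d : ℂ) + u' * Complex.I) * Complex.exp (β * Complex.I)) = |u - u'| := by
  rw [Complex.dist_eq, ← sub_mul, add_sub_add_left_eq_sub, ← sub_mul, norm_mul, norm_mul,
    Complex.norm_I, mul_one, Complex.norm_exp_ofReal_mul_I, mul_one, ← Complex.ofReal_sub,
    Complex.norm_real, Real.norm_eq_abs]

theorem isometricOn_linePath (hX : IsCAT0 (Space G)) (h : IsLinkPath v a) {Φ : ℝ → ℝ → Space G}
    (hΦ : ∀ r θ i, 0 ≤ r → r ≤ 1 / 10 → theta a i ≤ θ → θ < theta a (i + 1) →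
      AtPolar v a (Φ r θ) r θ i)
    {d θ₀ T : ℝ} (hd : 0 < d) (hT : 0 ≤ T) (hdT : d ^ 2 + T ^ 2 ≤ (1 / 10) ^ 2)
    (hθ : theta a 1 ≤ θ₀ + Real.arctan (-T / d)) : IsometricOn (linePath Φ d θ₀ T) 0 (2 * T) := by
  refine hX.isometricOn_of_local (by linarith) fun t ht => ?_
  set ϑ : ℝ → ℝ := fun s => θ₀ + Real.arctan ((s - T) / d) with hϑ
  set ϱ : ℝ → ℝ := fun s => √(d ^ 2 + (s - T) ^ 2) with hϱ
  have ϑcont : Continuous ϑ := by fun_prop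
  have ϑmono : Monotone ϑ := by
    intro s s' hss
    have : (s - T) / d ≤ (s' - T) / d := by gcongr
    simpa [hϑ] using Real.arctan_strictMono.monotone this
  have ϱpos : ∀ s, 0 < ϱ s := fun s => Real.sqrt_pos.2 (by positivity)
  have ϱle : ∀ s ∈ Set.Icc 0 (2 * T), ϱ s ≤ 1 / 10 := by
    intro s hs
    refine Real.sqrt_le_iff.2 ⟨by norm_num, ?_⟩
    have : (s - T) ^ 2 ≤ T ^ 2 := sq_le_sq' (by linarith [hs.1]) (by linarith [hs.2])
    linarith
  have ϑt : theta a 1 ≤ ϑ t := hθ.trans (by simpa [hϑ] using ϑmono ht.1)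
  obtain ⟨j, hj, hj'⟩ := exists_sector (a := a) ((theta_strictMono.monotone (Nat.zero_le 1)).trans ϑt)
  obtain ⟨i, rfl⟩ : ∃ i, j = i + 1 := by
    refine Nat.exists_eq_succ_of_ne_zero ?_
    rintro rfl
    exact absurd (ϑt.trans_lt hj') (lt_irrefl _)
  obtain ⟨ε₁, hε₁, hε⟩ := Metric.isOpen_iff.1 ((isOpen_Ioo (a := theta a i) (b := theta a (i + 1 + 1))).preimage
      ϑcont) t ⟨(theta_strictMono (Nat.lt_succ_self i)).trans_le hj, hj'⟩
  have near : ∀ s, |s - t| < ε₁ → theta a i < ϑ s ∧ ϑ s < theta a (i + 1 + 1) := fun s hs =>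
    hε (by rwa [Metric.mem_ball, Real.dist_eq])
  set γ := linePath Φ d θ₀ T with hγ
  have polar₁ : ∀ s ∈ Set.Icc 0 (2 * T), |s - t| < ε₁ → ϑ s < theta a (i + 1) →
      AtPolar v a (γ s) (ϱ s) (ϑ s) i := fun s hs hst hlt =>
    hΦ _ _ _ (ϱpos s).le (ϱle s hs) (near s hst).1.le hlt
  have polar₂ : ∀ s ∈ Set.Icc 0 (2 * T), |s - t| < ε₁ → theta a (i + 1) ≤ ϑ s →
      AtPolar v a (γ s) (ϱ s) (ϑ s) (i + 1) := fun s hs hst hle =>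
    hΦ _ _ _ (ϱpos s).le (ϱle s hs) hle (near s hst).2
  have apex : ∀ s ∈ Set.Icc 0 (2 * T), |s - t| < ε₁ → 0 < (γ s).1 (Sum.inl v) := by
    intro s hs hst
    rcases lt_or_ge (ϑ s) (theta a (i + 1)) with hlt | hle
    · exact (polar₁ s hs hst hlt).apex_pos h (ϱpos s).le (ϱle s hs) (near s hst).1.le hlt.le
    · exact (polar₂ s hs hst hle).apex_pos h (ϱpos s).le (ϱle s hs) hle (near s hst).2.le
  have axis : ∀ s ∈ Set.Icc 0 (2 * T), |s - t| < ε₁ → 0 < (γ s).1 (a (i + 1)) := by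
    intro s hs hst
    rcases lt_or_ge (ϑ s) (theta a (i + 1)) with hlt | hle
    · exact (polar₁ s hs hst hlt).right_pos h (ϱpos s) (near s hst).1 hlt.le
    · exact (polar₂ s hs hst hle).left_pos h (ϱpos s) hle (near s hst).2
  set E := develop v (a (i + 1)) (sideOf (a i)) with hE
  set β := θ₀ - theta a (i + 1) with hβ
  have develop_γ : ∀ s ∈ Set.Icc 0 (2 * T), |s - t| < ε₁ →
      E (γ s) = ((d : ℂ) + (s - T : ℝ) * Complex.I) * Complex.exp (β * Complex.I) := by
    intro s hs hst
    have e : E (γ s) = ϱ s * Complex.exp ((ϑ s - theta a (i + 1) : ℝ) * Complex.I) := by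
      rcases lt_or_ge (ϑ s) (theta a (i + 1)) with hlt | hle
      · exact (polar₁ s hs hst hlt).develop_right h (by simp [sideOf])
      · exact (polar₂ s hs hst hle).develop_left h (by simp [sideOf, (h.ne_add_two i).symm])
    rw [e, ← sqrt_mul_exp_arctan hd, mul_assoc, ← Complex.exp_add, ← add_mul, ← Complex.ofReal_add,
      show Real.arctan ((s - T) / d) + β = ϑ s - theta a (i + 1) by simp only [hϑ, hβ]; ring]
  have distE : ∀ s ∈ Set.Icc 0 (2 * T), ∀ s' ∈ Set.Icc 0 (2 * T), |s - t| < ε₁ → |s' - t| < ε₁ →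
      dist (E (γ s)) (E (γ s')) = |s - s'| := by
    intro s hs s' hs' hst hst'
    rw [develop_γ s hs hst, develop_γ s' hs' hst', dist_line_points, sub_sub_sub_cancel_right]
  have same : ∀ s ∈ Set.Icc 0 (2 * T), ∀ s' ∈ Set.Icc 0 (2 * T), |s - t| < ε₁ → |s' - t| < ε₁ →
      ∀ k, AtPolar v a (γ s) (ϱ s) (ϑ s) k → AtPolar v a (γ s') (ϱ s') (ϑ s') k →
      edist (γ s) (γ s') ≤ ENNReal.ofReal |s - s'| := by
    intro s hs s' hs' hst hst' k hk hk'
    obtain ⟨C, hC⟩ := h.exists_cell_contains k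
    refine (C.edist_le (hC _ _ _ hk) (hC _ _ _ hk')).trans ?_
    rw [h.dist_chart_eq i C (hC _ _ _ hk) (hC _ _ _ hk') (apex s hs hst) (axis s hs hst)
      (apex s' hs' hst') (axis s' hs' hst'), distE s hs s' hs' hst hst']
  have upper : ∀ s ∈ Set.Icc 0 (2 * T), ∀ s' ∈ Set.Icc 0 (2 * T), |s - t| < ε₁ → |s' - t| < ε₁ →
      s ≤ s' → edist (γ s) (γ s') ≤ ENNReal.ofReal |s - s'| := by
    intro s hs s' hs' hst hst' hss
    rcases lt_or_ge (ϑ s') (theta a (i + 1)) with hlt' | hle'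
    · exact same s hs s' hs' hst hst' i (polar₁ s hs hst ((ϑmono hss).trans_lt hlt'))
        (polar₁ s' hs' hst' hlt')
    rcases lt_or_ge (ϑ s) (theta a (i + 1)) with hlt | hle
    swap
    · exact same s hs s' hs' hst hst' (i + 1) (polar₂ s hs hst hle) (polar₂ s' hs' hst' hle')
    obtain ⟨u, hu, hue⟩ := exists_crossing hss hlt.le hle'
    have huI : u ∈ Set.Icc 0 (2 * T) := ⟨hs.1.trans hu.1, hu.2.trans hs'.2⟩
    have hut : |u - t| < ε₁ := by
      rw [abs_lt] at hst hst' ⊢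
      constructor <;> linarith [hu.1, hu.2]
    have p₂ := polar₂ u huI hut hue.ge
    have p₁ : AtPolar v a (γ u) (ϱ u) (ϑ u) i := by
      have hue' : ϑ u = theta a (i + 1) := hue
      rw [hue'] at p₂ ⊢
      exact (atPolar_succ_iff _ _ _).1 p₂
    refine (edist_triangle _ (γ u) _).trans ((add_le_add
      (same s hs u huI hst hut i (polar₁ s hs hst hlt) p₁)
      (same u huI s' hs' hut hst' (i + 1) p₂ (polar₂ s' hs' hst' hle'))).trans ?_)
    rw [← ENNReal.ofReal_add (abs_nonneg _) (abs_nonneg _)]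
    refine ENNReal.ofReal_le_ofReal ?_
    rw [abs_of_nonpos (by linarith [hu.1]), abs_of_nonpos (by linarith [hu.2]),
      abs_of_nonpos (by linarith)]
    linarith
  have upper' : ∀ s ∈ Set.Icc 0 (2 * T), ∀ s' ∈ Set.Icc 0 (2 * T), |s - t| < ε₁ → |s' - t| < ε₁ →
      edist (γ s) (γ s') ≤ ENNReal.ofReal |s - s'| := by
    intro s hs s' hs' hst hst'
    rcases le_total s s' with hss | hss
    · exact upper s hs s' hs' hst hst' hss
    · rw [edist_comm, abs_sub_comm]
      exact upper s' hs' s hs hst' hst hss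
  have ht0 : |t - t| < ε₁ := by simpa using hε₁
  set m := min ((γ t).1 (Sum.inl v)) ((γ t).1 (a (i + 1))) with hm
  have hm0 : 0 < m := lt_min (apex t ht ht0) (axis t ht ht0)
  refine ⟨min ε₁ (m / 50), by positivity, fun s hs s' hs' hst hst' => ?_⟩
  have hst₁ := hst.trans_le (min_le_left _ _)
  have hst₁' := hst'.trans_le (min_le_left _ _)
  have hst₂ := hst.trans_le (min_le_right _ _)
  have hst₂' := hst'.trans_le (min_le_right _ _)
  refine le_antisymm (upper' s hs s' hs' hst₁ hst₁') (not_lt.1 fun hlt => ?_)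
  obtain ⟨L, hL, hLlt⟩ := edist_lt_iff.1 hlt
  have hLr : (L : ℝ) < |s - s'| := by
    rw [← ENNReal.ofReal_coe_nnreal] at hLlt
    exact (ENNReal.ofReal_lt_ofReal_iff_of_nonneg L.2).1 hLlt
  let F : Space G → ℝ := fun x => (E x * Complex.exp ((-β : ℝ) * Complex.I)).im
  have Fγ : ∀ u ∈ Set.Icc 0 (2 * T), |u - t| < ε₁ → F (γ u) = u - T := by
    intro u hu hut
    simp only [F]
    rw [develop_γ u hu hut, mul_assoc, ← Complex.exp_add, ← add_mul, ← Complex.ofReal_add,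
      add_neg_cancel, Complex.ofReal_zero, zero_mul, Complex.exp_zero, mul_one]
    simp
  have hF : ∀ (C : Cell G) (x y : Space G), C.Contains x → C.Contains y → 0 < x.1 (Sum.inl v) →
      0 < x.1 (a (i + 1)) → 0 < y.1 (Sum.inl v) → 0 < y.1 (a (i + 1)) →
      |F x - F y| ≤ dist (C.chart x) (C.chart y) := by
    intro C x y hx hy h1 h2 h3 h4
    rw [h.dist_chart_eq i C hx hy h1 h2 h3 h4, Complex.dist_eq]
    simp only [F]
    rw [← Complex.sub_im, ← sub_mul]
    refine (Complex.abs_im_le_norm _).trans ?_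
    rw [norm_mul, Complex.norm_exp_ofReal_mul_I, mul_one]
  have hss : |s - s'| ≤ |s - t| + |s' - t| := by
    have := abs_sub_le s t s'
    rwa [abs_sub_comm t s'] at this
  rcases hL.variation_le hF with hvar | ⟨w, hw, hle⟩
  · have := (hvar (apex s hs hst₁) (axis s hs hst₁)).1
    rw [Fγ s hs hst₁, Fγ s' hs' hst₁', sub_sub_sub_cancel_right] at this
    linarith
  · have hwm : m ≤ (γ t).1 w := by
      rcases hw with rfl | rfl
      exacts [min_le_left _ _, min_le_right _ _]
    have c₁ := abs_coord_sub_le_of_edist_le (abs_nonneg _) (upper' s hs t ht hst₁ ht0) w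
    have c₂ := abs_coord_sub_le_of_edist_le (abs_nonneg _) (upper' s' hs' t ht hst₁' ht0) w
    have c₁' := (abs_le.1 c₁).1
    have c₂' := (abs_le.1 c₂).1
    linarith

/-- In a CAT(0) triangle-pentagon complex, a closed path of length less than `2π` in the link of a
vertex of `X` is not injective. -/
theorem no_short_periodic_path (hX : IsCAT0 (Space G)) (h : IsLinkPath v a) {n : ℕ} (hn : 3 ≤ n)
    (hper : ∀ i j, a i = a j ↔ (i : ZMod n) = j) (hlen : theta a n < 2 * Real.pi) : False := by
  obtain ⟨Φ, hΦ⟩ := exists_polar_map h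
  have hπ := Real.pi_pos
  set L := theta a n with hL
  have hL0 : 0 < L := by
    have := theta_strictMono (a := a) (show 0 < n by omega)
    rwa [theta_zero] at this
  have a1 : a (n + 1) = a 1 := (hper _ _).2 (by simp)
  have a2 : a (n + 1 + 1) = a (1 + 1) := (hper _ _).2 (by simp [one_add_one_eq_two])
  have htheta : theta a (n + 1) = theta a 1 + L := by
    rw [theta_succ, theta_succ, theta_zero, a1, (hper n 0).2 (by simp), zero_add, add_comm]
  set d := Real.cos (L / 4) / 10 with hd
  set T := Real.sin (L / 4) / 10 with hT
  have hd0 : 0 < d := by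
    have := Real.cos_pos_of_mem_Ioo (x := L / 4) ⟨by linarith, by linarith⟩
    positivity
  have hT0 : 0 < T := by
    have := Real.sin_pos_of_pos_of_lt_pi (x := L / 4) (by linarith) (by linarith)
    positivity
  have hdT : d ^ 2 + T ^ 2 = (1 / 10) ^ 2 := by
    linear_combination (1 / 100) * Real.sin_sq_add_cos_sq (L / 4)
  have harc : Real.arctan (T / d) = L / 4 := by
    rw [hT, hd, div_div_div_cancel_right₀ (by norm_num), ← Real.tan_eq_sin_div_cos]
    exact Real.arctan_tan (by linarith) (by linarith)
  have harc' : Real.arctan (-T / d) = -(L / 4) := by rw [neg_div, Real.arctan_neg, harc]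
  have hr : √(d ^ 2 + T ^ 2) = 1 / 10 := by rw [hdT]; exact Real.sqrt_sq (by norm_num)
  have start : ∀ θ₀, linePath Φ d θ₀ T 0 = Φ (1 / 10) (θ₀ - L / 4) := by
    intro θ₀
    rw [linePath, zero_sub, neg_sq, hr, harc', ← sub_eq_add_neg]
  have finish : ∀ θ₀, linePath Φ d θ₀ T (2 * T) = Φ (1 / 10) (θ₀ + L / 4) := by
    intro θ₀
    rw [linePath, show 2 * T - T = T by ring, hr, harc]
  have middle : ∀ θ₀, linePath Φ d θ₀ T T = Φ d θ₀ := by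
    intro θ₀
    rw [linePath, sub_self, zero_div, Real.arctan_zero, add_zero]
    congr 1
    rw [zero_pow two_ne_zero, add_zero, Real.sqrt_sq hd0.le]
  have iso₁ := isometricOn_linePath hX h hΦ (θ₀ := theta a 1 + L / 4) hd0 hT0.le hdT.le
    (by rw [harc']; linarith)
  have iso₂ := isometricOn_linePath hX h hΦ (θ₀ := theta a 1 + 3 * L / 4) hd0 hT0.le hdT.le
    (by rw [harc']; linarith)
  have hclosed : Φ (1 / 10) (theta a 1 + L) = Φ (1 / 10) (theta a 1) := by
    have p₁ := hΦ (1 / 10) (theta a 1) 1 (by norm_num) le_rfl le_rfl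
      (theta_strictMono (Nat.lt_succ_self _))
    have p₂ := hΦ (1 / 10) (theta a (n + 1)) (n + 1) (by norm_num) le_rfl le_rfl
      (theta_strictMono (Nat.lt_succ_self _))
    rw [← htheta]
    refine Subtype.ext (p₂.trans (Eq.trans ?_ p₁.symm))
    rw [theta_succ (n + 1), theta_succ 1, a1, a2, add_sub_cancel_left, add_sub_cancel_left, sub_self,
      sub_self]
  have g₁ : IsGeodesic (linePath Φ d (theta a 1 + L / 4) T) (2 * T) (Φ (1 / 10) (theta a 1))
      (Φ (1 / 10) (theta a 1 + L / 2)) := by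
    refine ⟨by linarith, ?_, ?_, iso₁⟩
    · rw [start]; congr 1; ring
    · rw [finish]; congr 1; ring
  have g₂ : IsGeodesic (fun s => linePath Φ d (theta a 1 + 3 * L / 4) T (2 * T - s)) (2 * T)
      (Φ (1 / 10) (theta a 1)) (Φ (1 / 10) (theta a 1 + L / 2)) := by
    refine ⟨by linarith, ?_, ?_, fun s hs s' hs' => ?_⟩
    · simp only [sub_zero]
      rw [finish, ← hclosed]; congr 1; ring
    · simp only [sub_self]
      rw [start]; congr 1; ring
    · rw [iso₂ _ ⟨by linarith [hs.2], by linarith [hs.1]⟩ _ ⟨by linarith [hs'.2], by linarith [hs'.1]⟩,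
        abs_sub_comm]
      congr 2; ring
  have hmid := eq_of_edist_eq_zero (hX.edist_eq_zero_of_isGeodesic g₁ g₂ (t := T)
    ⟨hT0.le, by linarith⟩)
  simp only [show 2 * T - T = T by ring, middle] at hmid
  have hd1 : d ≤ 1 / 10 := by
    have := Real.cos_le_one (L / 4)
    linarith
  have th1 : 0 < theta a 1 := by
    have := theta_strictMono (a := a) one_pos
    rwa [theta_zero] at this
  obtain ⟨i, hi, hi'⟩ := exists_sector (a := a) (θ := theta a 1 + L / 4) (by linarith)
  obtain ⟨j, hj, hj'⟩ := exists_sector (a := a) (θ := theta a 1 + 3 * L / 4) (by linarith)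
  have pi := hΦ d _ i hd0.le hd1 hi hi'
  have pj := hΦ d _ j hd0.le hd1 hj hj'
  have mi := pi.left_pos h hd0 hi hi'
  have mj := pj.left_pos h hd0 hj hj'
  rw [← hmid] at mj pj
  have si : a i = a j ∨ a i = a (j + 1) := by
    have := Finsupp.mem_support_iff.2 mi.ne'
    rw [pj] at this
    exact (support_sectorFun_subset _ _ _ _ this).resolve_left (h.ne_apex i)
  have sj : a j = a i ∨ a j = a (i + 1) := by
    have := Finsupp.mem_support_iff.2 mj.ne'
    rw [pi] at this
    exact (support_sectorFun_subset _ _ _ _ this).resolve_left (h.ne_apex j)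
  have hij : a i = a j := by
    rcases si with h1 | h1
    · exact h1
    rcases sj with h2 | h2
    · exact h2.symm
    refine absurd ((hper i (i + 2)).2 ?_) (h.ne_add_two i)
    rw [hper] at h1 h2
    push_cast at h1 h2 ⊢
    linear_combination h1 + h2
  obtain rfl : i = j := by
    have b1 := theta_strictMono.lt_iff_lt.1 (hj.trans_lt (by linarith : _ < theta a (n + 1)))
    have b2 := theta_strictMono.lt_iff_lt.1 (hi.trans_lt (by linarith : _ < theta a (n + 1)))
    have b3 := theta_strictMono.lt_iff_lt.1 ((by linarith : theta a 1 < _).trans hi')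
    have b4 := theta_strictMono.lt_iff_lt.1 ((by linarith : theta a 1 < _).trans hj')
    have := (ZMod.natCast_eq_natCast_iff _ _ _).1 ((hper i j).1 hij)
    refine this.eq_of_abs_lt ?_
    rw [abs_lt]
    omega
  have e := (congrArg (fun f => f (a i)) (pi.symm.trans pj))
  simp only [h.sectorFun_apply_left] at e
  have q1 := len_pos (a i)
  have q2 := sin_ang_pos (a i) (a (i + 1))
  rw [div_left_inj' (by positivity), mul_right_inj' hd0.ne'] at e
  have hs := theta_succ (a := a) i
  have hang := ang_le (a i) (a (i + 1))
  have := Real.injOn_sin ⟨by linarith, by linarith⟩ ⟨by linarith, by linarith⟩ e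
  linarith

end Loops

/-! ### Cycles in links, flagness and dwheels -/

section LinkCycles

variable {V : Type*} {G : SimpleGraph V}

/-- The edges of the closed polygon `c` span simplices with `x`. -/
structure IsLinkCycle (x : V ⊕ Pentagon G) (n : ℕ) (c : ZMod n → V ⊕ Pentagon G) : Prop where
  three_le : 3 ≤ n
  injective : Function.Injective c
  ne_apex : ∀ i, c i ≠ x
  face : ∀ i, ∃ s ∈ (subdivision G).faces, x ∈ s ∧ c i ∈ s ∧ c (i + 1) ∈ s

theorem IsLinkCycle.isLinkPath {v : V} {n : ℕ} {c : ZMod n → V ⊕ Pentagon G}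
    (h : IsLinkCycle (Sum.inl v) n c) : IsLinkPath v (fun k : ℕ => c k) where
  face i := by simpa using h.face i
  ne_apex i := h.ne_apex i
  ne_succ i := by
    have : Fact (1 < n) := ⟨by linarith [h.three_le]⟩
    simp [h.injective.eq_iff]
  ne_add_two i := by
    have h2 : ((2 : ℕ) : ZMod n) ≠ 0 := by
      rw [Ne, ZMod.natCast_eq_zero_iff]
      exact Nat.not_dvd_of_pos_of_lt two_pos (by linarith [h.three_le])
    simpa [h.injective.eq_iff] using h2

theorem IsLinkCycle.two_pi_le (hX : IsCAT0 (Space G)) {v : V} {n : ℕ} {c : ZMod n → V ⊕ Pentagon G}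
    (h : IsLinkCycle (Sum.inl v) n c) : 2 * Real.pi ≤ theta (fun k : ℕ => c k) n :=
  not_lt.1 fun hlt => no_short_periodic_path hX h.isLinkPath h.three_le
    (fun _ _ => h.injective.eq_iff) hlt

theorem theta_le (a : ℕ → V ⊕ Pentagon G) (n : ℕ) : theta a n ≤ n * (Real.pi / 3) := by
  rw [theta, ← nsmul_eq_mul, ← Finset.card_range n, ← Finset.sum_const, Finset.card_range]
  exact Finset.sum_le_sum fun j _ => ang_le _ _

theorem theta_lt {a : ℕ → V ⊕ Pentagon G} {n j : ℕ} (hj : j < n) (h : ¬ (a j).isLeft) :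
    theta a n < n * (Real.pi / 3) := by
  rw [theta, ← nsmul_eq_mul, ← Finset.card_range n, ← Finset.sum_const, Finset.card_range]
  refine Finset.sum_lt_sum (fun j _ => ang_le _ _) ⟨j, Finset.mem_range.2 hj, ?_⟩
  rw [ang, if_neg fun h' => h h'.1]
  linarith [Real.pi_pos]

theorem IsLinkCycle.six_le (hX : IsCAT0 (Space G)) {v : V} {n : ℕ} {c : ZMod n → V ⊕ Pentagon G}
    (h : IsLinkCycle (Sum.inl v) n c) : 6 ≤ n := by
  have h1 := (h.two_pi_le hX).trans (theta_le _ _)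
  have h2 : (6 : ℝ) ≤ n := by
    by_contra! hlt
    nlinarith [Real.pi_pos]
  exact_mod_cast h2

theorem IsLinkCycle.seven_le (hX : IsCAT0 (Space G)) {v : V} {n : ℕ} {c : ZMod n → V ⊕ Pentagon G}
    (h : IsLinkCycle (Sum.inl v) n c) {i : ZMod n} {P : Pentagon G} (hi : c i = Sum.inr P) :
    7 ≤ n := by
  have : NeZero n := ⟨by linarith [h.three_le]⟩
  have h1 := (h.two_pi_le hX).trans_lt (theta_lt (ZMod.val_lt i) (by simp [hi]))
  have h2 : (6 : ℝ) < n := by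
    by_contra! hlt
    nlinarith [Real.pi_pos]
  exact_mod_cast h2

theorem IsLinkCycle.five_le_of_center {P : Pentagon G} {n : ℕ} {c : ZMod n → V ⊕ Pentagon G}
    (h : IsLinkCycle (Sum.inr P) n c) : 5 ≤ n := by
  obtain ⟨φ, hφ⟩ := P.exists_embedding
  have key : ∀ i, ∃ k : Fin 5, c i = Sum.inl (φ k) := by
    intro i
    obtain ⟨s, hs, hP, hi, -⟩ := h.face i
    rcases hc : c i with u | Q
    · rw [hc] at hi
      obtain ⟨k, hk⟩ := hφ.symm ▸ mem_of_mem_face hs hi hP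
      exact ⟨k, by rw [hk]⟩
    · rw [hc] at hi
      exact absurd (by rw [hc, eq_of_mem_face hs hi hP]) (h.ne_apex i)
  choose g hg using key
  have hinj : Function.Injective g := fun i j hij => h.injective (by rw [hg, hg, hij])
  have : Fact (1 < n) := ⟨by linarith [h.three_le]⟩
  have hadj : ∀ i, (SimpleGraph.cycleGraph 5).Adj (g i) (g (i + 1)) := by
    intro i
    obtain ⟨s, hs, -, hi, hi'⟩ := h.face i
    rw [hg] at hi hi'
    refine φ.map_rel_iff.1 (adj_of_mem_face hs hi hi' fun he => ?_)
    simpa using hinj (φ.injective he)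
  by_contra! hlt
  have h3 := h.three_le
  clear hg h
  obtain rfl | rfl : n = 3 ∨ n = 4 := by omega
  · have h0 := hadj 0
    have h1 := hadj 1
    have h2 := hadj 2
    rw [show (0 : ZMod 3) + 1 = 1 from rfl] at h0
    rw [show (1 : ZMod 3) + 1 = 2 from rfl] at h1
    rw [show (2 : ZMod 3) + 1 = 0 from rfl] at h2
    generalize g 0 = x at *
    generalize g 1 = y at *
    generalize g 2 = z at *
    clear hinj hadj hφ
    revert x y z
    simp only [SimpleGraph.cycleGraph_adj]
    decide
  · have h0 := hadj 0
    have h1 := hadj 1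
    have h2 := hadj 2
    have h3 := hadj 3
    have h02 : g 0 ≠ g 2 := fun h => absurd (hinj h) (by decide)
    have h13 : g 1 ≠ g 3 := fun h => absurd (hinj h) (by decide)
    rw [show (0 : ZMod 4) + 1 = 1 from rfl] at h0
    rw [show (1 : ZMod 4) + 1 = 2 from rfl] at h1
    rw [show (2 : ZMod 4) + 1 = 3 from rfl] at h2
    rw [show (3 : ZMod 4) + 1 = 0 from rfl] at h3
    generalize g 0 = x at *
    generalize g 1 = y at *
    generalize g 2 = z at *
    generalize g 3 = w at *
    clear hinj hadj hφ
    revert x y z w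
    simp only [SimpleGraph.cycleGraph_adj]
    decide

theorem IsLinkCycle.five_le (hX : IsCAT0 (Space G)) {x : V ⊕ Pentagon G} {n : ℕ}
    {c : ZMod n → V ⊕ Pentagon G} (h : IsLinkCycle x n c) : 5 ≤ n := by
  rcases x with v | P
  · linarith [h.six_le hX]
  · exact h.five_le_of_center

theorem triangle_mem_faces {u v w : V} (h₁ : G.Adj u v) (h₂ : G.Adj v w) (h₃ : G.Adj u w)
    {s : Finset (V ⊕ Pentagon G)} (hs : s.Nonempty)
    (hsub : (s : Set (V ⊕ Pentagon G)) ⊆ {Sum.inl u, Sum.inl v, Sum.inl w}) :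
    s ∈ (subdivision G).faces :=
  ⟨hs, _, Or.inl (Or.inr ⟨u, v, w, h₁, h₂, h₃, rfl⟩), hsub⟩

theorem cone_mem_faces {P : Pentagon G} {u v : V} (hu : u ∈ P.1) (hv : v ∈ P.1) (h : G.Adj u v)
    {s : Finset (V ⊕ Pentagon G)} (hs : s.Nonempty)
    (hsub : (s : Set (V ⊕ Pentagon G)) ⊆ {Sum.inr P, Sum.inl u, Sum.inl v}) :
    s ∈ (subdivision G).faces :=
  ⟨hs, _, Or.inr ⟨P, u, v, hu, hv, h, rfl⟩, hsub⟩

theorem not_complete_four (hX : IsCAT0 (Space G)) {u v w x : V} (huv : G.Adj u v) (huw : G.Adj u w)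
    (hux : G.Adj u x) (hvw : G.Adj v w) (hvx : G.Adj v x) (hwx : G.Adj w x) : False := by
  classical
  let c : ZMod 3 → V ⊕ Pentagon G := ![Sum.inl v, Sum.inl w, Sum.inl x]
  have h : IsLinkCycle (Sum.inl u) 3 c := by
    refine ⟨le_rfl, ?_, ?_, ?_⟩
    · intro i j hij
      fin_cases i <;> fin_cases j <;> first
        | rfl
        | simp [c, hvw.ne, hvx.ne, hwx.ne, hvw.ne', hvx.ne', hwx.ne'] at hij
    · intro i
      fin_cases i <;> simp [c, huv.ne', huw.ne', hux.ne']
    · intro i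
      fin_cases i
      · exact ⟨{Sum.inl u, Sum.inl v, Sum.inl w}, triangle_mem_faces huv hvw huw (Finset.insert_nonempty _ _)
          (by simp), by simp, Finset.mem_insert_of_mem (Finset.mem_insert_self _ _),
          Finset.mem_insert_of_mem (Finset.mem_insert_of_mem (Finset.mem_singleton_self _))⟩
      · exact ⟨{Sum.inl u, Sum.inl w, Sum.inl x}, triangle_mem_faces huw hwx hux (Finset.insert_nonempty _ _)
          (by simp), by simp, Finset.mem_insert_of_mem (Finset.mem_insert_self _ _),
          Finset.mem_insert_of_mem (Finset.mem_insert_of_mem (Finset.mem_singleton_self _))⟩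
      · exact ⟨{Sum.inl u, Sum.inl x, Sum.inl v}, triangle_mem_faces hux hvx.symm huv (Finset.insert_nonempty _ _)
          (by simp), by simp, Finset.mem_insert_of_mem (Finset.mem_insert_self _ _),
          Finset.mem_insert_of_mem (Finset.mem_insert_of_mem (Finset.mem_singleton_self _))⟩
  have := h.six_le hX
  omega

theorem joined_iff {W : Type*} {K : PreAbstractSimplicialComplex W} {u v : W} :
    Joined K u v ↔ ∃ s ∈ K.faces, u ∈ s ∧ v ∈ s := by
  classical
  constructor
  · rintro ⟨e, he, h⟩
    exact ⟨e, he, by rw [← Finset.mem_coe, h]; simp, by rw [← Finset.mem_coe, h]; simp⟩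
  · rintro ⟨s, hs, hu, hv⟩
    refine ⟨{u, v}, mem_faces_of_subset hs ?_ ⟨u, by simp⟩, by simp⟩
    intro x hx
    rcases Finset.mem_insert.1 hx with rfl | hx
    · exact hu
    · rwa [Finset.mem_singleton.1 hx]

theorem Pentagon.exists_adj (P : Pentagon G) {u : V} (hu : u ∈ P.1) : ∃ w ∈ P.1, G.Adj u w := by
  obtain ⟨φ, hφ⟩ := P.exists_embedding
  rw [← hφ] at hu ⊢
  obtain ⟨i, rfl⟩ := hu
  exact ⟨φ (i + 1), ⟨_, rfl⟩, φ.map_rel_iff.2 (SimpleGraph.cycleGraph_adj.2 (by simp))⟩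

theorem Pentagon.nonempty (P : Pentagon G) : P.1.Nonempty := by
  obtain ⟨φ, hφ⟩ := P.exists_embedding
  exact ⟨φ 0, hφ ▸ ⟨0, rfl⟩⟩

theorem Pentagon.not_triangle (P : Pentagon G) {u v w : V} (hu : u ∈ P.1) (hv : v ∈ P.1)
    (hw : w ∈ P.1) (h₁ : G.Adj u v) (h₂ : G.Adj u w) (h₃ : G.Adj v w) : False := by
  obtain ⟨φ, hφ⟩ := P.exists_embedding
  rw [← hφ] at hu hv hw
  obtain ⟨i, rfl⟩ := hu
  obtain ⟨j, rfl⟩ := hv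
  obtain ⟨k, rfl⟩ := hw
  exact not_triangle_of_pentagon φ h₁ h₂ h₃

theorem isFlag_subdivision (hX : IsCAT0 (Space G)) : IsFlag (subdivision G) := by
  intro s hs hjoin
  have adj : ∀ u w, Sum.inl u ∈ s → Sum.inl w ∈ s → u ≠ w → G.Adj u w := by
    intro u w hu hw hne
    obtain ⟨t, ht, hut, hwt⟩ := joined_iff.1 (hjoin _ hu _ hw)
    exact adj_of_mem_face ht hut hwt hne
  by_cases hP : ∃ P, Sum.inr P ∈ s
  · obtain ⟨P, hP⟩ := hP
    have mem : ∀ u, Sum.inl u ∈ s → u ∈ P.1 := by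
      intro u hu
      obtain ⟨t, ht, hut, hPt⟩ := joined_iff.1 (hjoin _ hu _ hP)
      exact mem_of_mem_face ht hut hPt
    have center : ∀ Q, Sum.inr Q ∈ s → Q = P := by
      intro Q hQ
      obtain ⟨t, ht, hQt, hPt⟩ := joined_iff.1 (hjoin _ hQ _ hP)
      exact eq_of_mem_face ht hQt hPt
    obtain ⟨u, hu, w, hw, huw, hall⟩ : ∃ u ∈ P.1, ∃ w ∈ P.1, G.Adj u w ∧
        ∀ x, Sum.inl x ∈ s → x = u ∨ x = w := by
      by_cases h0 : ∃ u, Sum.inl u ∈ s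
      · obtain ⟨u, hu⟩ := h0
        by_cases h1 : ∃ w, Sum.inl w ∈ s ∧ w ≠ u
        · obtain ⟨w, hw, hwu⟩ := h1
          refine ⟨u, mem u hu, w, mem w hw, adj _ _ hu hw hwu.symm, fun x hx => ?_⟩
          by_contra! hne
          exact P.not_triangle (mem u hu) (mem w hw) (mem x hx) (adj _ _ hu hw hwu.symm)
            (adj _ _ hu hx hne.1.symm) (adj _ _ hw hx hne.2.symm)
        · push Not at h1
          obtain ⟨w, hw, huw⟩ := P.exists_adj (mem u hu)
          exact ⟨u, mem u hu, w, hw, huw, fun x hx => Or.inl (h1 x hx)⟩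
      · obtain ⟨u, hu⟩ := P.nonempty
        obtain ⟨w, hw, huw⟩ := P.exists_adj hu
        exact ⟨u, hu, w, hw, huw, fun x hx => absurd ⟨x, hx⟩ h0⟩
    refine cone_mem_faces hu hw huw hs ?_
    rintro (x | Q) hx
    · rcases hall x hx with rfl | rfl <;> simp
    · rw [center Q hx]; simp
  · push Not at hP
    obtain ⟨u | P, hu⟩ := hs
    swap
    · exact absurd hu (hP P)
    by_cases h1 : ∃ w, Sum.inl w ∈ s ∧ w ≠ u
    swap
    · push Not at h1
      refine ⟨⟨_, hu⟩, _, Or.inl (Or.inl (Or.inl ⟨u, rfl⟩)), ?_⟩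
      rintro (x | Q) hx
      · rw [h1 x hx]; simp
      · exact absurd hx (hP Q)
    obtain ⟨w, hw, hwu⟩ := h1
    have huw := adj _ _ hu hw hwu.symm
    by_cases h2 : ∃ x, Sum.inl x ∈ s ∧ x ≠ u ∧ x ≠ w
    swap
    · push Not at h2
      refine ⟨⟨_, hu⟩, _, Or.inl (Or.inl (Or.inr ⟨u, w, huw, rfl⟩)), ?_⟩
      rintro (x | Q) hx
      · by_cases hxu : x = u
        · simp [hxu]
        · simp [h2 x hx hxu]
      · exact absurd hx (hP Q)
    obtain ⟨x, hx, hxu, hxw⟩ := h2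
    have hux := adj _ _ hu hx hxu.symm
    have hwx := adj _ _ hw hx hxw.symm
    refine triangle_mem_faces huw hwx hux ⟨_, hu⟩ ?_
    rintro (y | Q) hy
    · by_contra hne
      simp only [Set.mem_insert_iff, Sum.inl.injEq, Set.mem_singleton_iff, not_or] at hne
      exact not_complete_four hX huw hux (adj _ _ hu hy (Ne.symm hne.1)) hwx
        (adj _ _ hw hy (Ne.symm hne.2.1)) (adj _ _ hx hy (Ne.symm hne.2.2))
    · exact absurd hy (hP Q)

theorem IsFlag.link {W : Type*} {K : PreAbstractSimplicialComplex W} (hK : IsFlag K)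
    {σ : Finset W} (hσ : σ ∈ K.faces) : IsFlag (link K σ) := by
  classical
  intro s hs hjoin
  have hpair : ∀ u ∈ s, ∀ v ∈ s, u ∉ σ ∧ ∃ υ ∈ K.faces, u ∈ υ ∧ v ∈ υ ∧ σ ⊆ υ := by
    intro u hu v hv
    obtain ⟨t, ⟨-, hd, υ, hυ, he⟩, hut, hvt⟩ := joined_iff.1 (hjoin u hu v hv)
    have hsub : ∀ x, x ∈ t ∨ x ∈ σ → x ∈ υ := by
      intro x hx
      rw [← Finset.mem_coe, he]
      exact hx
    exact ⟨fun hσ => Set.disjoint_left.1 hd hut hσ, υ, hυ, hsub _ (Or.inl hut), hsub _ (Or.inl hvt),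
      fun x hx => hsub _ (Or.inr hx)⟩
  refine ⟨hs, Set.disjoint_left.2 fun u hu => (hpair u hu u hu).1, s ∪ σ, ?_, by simp⟩
  refine hK _ (hs.mono Finset.subset_union_left) ?_
  intro u hu v hv
  rw [joined_iff]
  rcases Finset.mem_union.1 hu with hu | hu <;> rcases Finset.mem_union.1 hv with hv | hv
  · obtain ⟨-, υ, hυ, h1, h2, -⟩ := hpair u hu v hv
    exact ⟨υ, hυ, h1, h2⟩
  · obtain ⟨-, υ, hυ, h1, -, h2⟩ := hpair u hu u hu
    exact ⟨υ, hυ, h1, h2 hv⟩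
  · obtain ⟨-, υ, hυ, h1, -, h2⟩ := hpair v hv v hv
    exact ⟨υ, hυ, h2 hu, h1⟩
  · exact ⟨σ, hσ, hu, hv⟩

theorem isLocallyLarge_subdivision (hX : IsCAT0 (Space G)) : IsLocallyLarge 5 (subdivision G) := by
  classical
  intro σ hσ
  refine ⟨(isFlag_subdivision hX).link hσ, fun j hj c hc => ?_⟩
  obtain ⟨x, hx⟩ := hσ.1
  have hface : ∀ i, ({c i, c (i + 1)} : Finset _) ∈ (link (subdivision G) σ).faces := fun i =>
    (hc.2.2 _ (by simp [Set.insert_subset_iff])).2 ⟨⟨c i, by simp⟩, i, by simp⟩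
  have h : IsLinkCycle x j c := by
    refine ⟨hc.1, hc.2.1, fun i => ?_, fun i => ?_⟩
    · rintro rfl
      exact Set.disjoint_left.1 (hface i).2.1 (by simp) hx
    · obtain ⟨-, -, υ, hυ, he⟩ := hface i
      refine ⟨υ, hυ, ?_, ?_, ?_⟩ <;> rw [← Finset.mem_coe, he] <;> simp [hx]
  have := h.five_le hX
  omega

theorem IsFullWheel.isLinkCycle {x : V ⊕ Pentagon G} {n : ℕ} {c : ZMod n → V ⊕ Pentagon G}
    (h : IsFullWheel (subdivision G) n x c) : IsLinkCycle x n c := by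
  classical
  refine ⟨h.1.1, h.1.2.1, fun i hi => h.2.1 ⟨i, hi⟩, fun i => ⟨{x, c i, c (i + 1)}, ?_, by simp,
    by simp, by simp⟩⟩
  exact (h.2.2 _ (by simp [Set.insert_subset_iff])).2 ⟨⟨x, by simp⟩, i, by simp⟩

/-- There are no dwheels with boundary of length at most `7`. -/
theorem twelve_le_of_isWheelPair (hX : IsCAT0 (Space G)) {k l : ℕ} {v : ZMod k → V ⊕ Pentagon G}
    {w : ZMod l → V ⊕ Pentagon G} (h : IsWheelPair (subdivision G) k l v w) : 12 ≤ k + l := by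
  have h₁ := h.1.isLinkCycle
  have h₂ := h.2.1.isLinkCycle
  rcases hw : w 0 with x | P
  · rw [hw] at h₁
    rcases hv : v 2 with y | Q
    · rw [hv] at h₂
      linarith [h₁.six_le hX, h₂.six_le hX]
    · linarith [h₁.seven_le hX hv, h₂.five_le hX]
  · rcases hv : v 2 with y | Q
    · rw [hv] at h₂
      linarith [h₁.five_le hX, h₂.seven_le hX hw]
    · exfalso
      obtain ⟨s, hs, h3, h4, -⟩ := h₁.face 2
      rw [hw] at h3
      rw [hv] at h4
      exact h₁.ne_apex 2 (by rw [hw, hv, eq_of_mem_face hs h3 h4])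

theorem isLocated_subdivision (hX : IsCAT0 (Space G)) : IsLocated 7 (subdivision G) := by
  refine ⟨isFlag_subdivision hX, fun k l v w h => ?_⟩
  have h12 := twelve_le_of_isWheelPair hX h.1
  rcases h.2 with h' | h' <;> omega

end LinkCycles

/-! ### Cocompact actions -/

section Cocompact

variable {W Γ : Type*} [Group Γ] {K : PreAbstractSimplicialComplex W} {ρ : Γ →* Aut K}

/-- The action has finitely many orbits of simplices. -/
def HasFinitelyManyOrbits (K : PreAbstractSimplicialComplex W) (ρ : Γ →* Aut K) : Prop :=
  ∃ F : Set (Finset W), F.Finite ∧ F ⊆ K.faces ∧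
    ∀ s ∈ K.faces, ∃ t ∈ F, ∃ γ : Γ, t.map (ρ γ : Equiv.Perm W).toEmbedding = s

/-- The point `x` is the barycentre of a simplex. -/
def IsBarycenter (x : Realization K) : Prop := ∀ w ∈ x.1.support, x.1 w = 1 / x.1.support.card

theorem SameOrbit.support_eq {x y : Realization K} {γ : Γ}
    (h : ∀ v : W, y.1 ((ρ γ : Equiv.Perm W) v) = x.1 v) :
    y.1.support = x.1.support.map (ρ γ : Equiv.Perm W).toEmbedding := by
  ext w
  rw [Finset.mem_map_equiv, Finsupp.mem_support_iff, Finsupp.mem_support_iff, ← h]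
  simp

theorem SameOrbit.isBarycenter_iff {x y : Realization K} (h : SameOrbit K ρ x y) :
    IsBarycenter x ↔ IsBarycenter y := by
  obtain ⟨γ, h⟩ := h
  rw [IsBarycenter, IsBarycenter, SameOrbit.support_eq h, Finset.card_map]
  simp only [Finset.mem_map, Equiv.coe_toEmbedding, forall_exists_index, and_imp,
    forall_apply_eq_imp_iff₂, h]

theorem SameOrbit.exists_map_iff {x y : Realization K} (h : SameOrbit K ρ x y) (t : Finset W) :
    (∃ γ : Γ, t.map (ρ γ : Equiv.Perm W).toEmbedding = x.1.support) ↔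
      ∃ γ : Γ, t.map (ρ γ : Equiv.Perm W).toEmbedding = y.1.support := by
  obtain ⟨δ, h⟩ := h
  rw [SameOrbit.support_eq h]
  constructor
  · rintro ⟨γ, hγ⟩
    refine ⟨δ * γ, ?_⟩
    rw [← hγ, Finset.map_map]
    congr 1
    ext w
    simp
  · rintro ⟨γ, hγ⟩
    refine ⟨δ⁻¹ * γ, ?_⟩
    have := congrArg (Finset.map ((ρ δ : Equiv.Perm W)⁻¹).toEmbedding) hγ
    rw [Finset.map_map, Finset.map_map] at this
    refine Eq.trans ?_ (this.trans ?_)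
    · congr 1
      ext w
      simp
    · ext w; simp

theorem exists_isBarycenter {s : Finset W} (hs : s ∈ K.faces) :
    ∃ x : Realization K, x.1.support = s ∧ IsBarycenter x := by
  classical
  let f : W →₀ ℝ := Finsupp.indicator s fun _ _ => (1 / s.card : ℝ)
  have hcard : (s.card : ℝ) ≠ 0 := by
    have := (K.isRelLowerSet_faces hs).1.card_pos
    positivity
  have hsupp : f.support = s := by
    ext w
    rw [Finsupp.mem_support_iff, Finsupp.indicator_apply]
    by_cases h : w ∈ s
    · simp only [h, dite_true, iff_true]
      exact one_div_ne_zero hcard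
    · simp [h]
  have hf : ∀ w ∈ s, f w = 1 / s.card := fun w hw => Finsupp.indicator_of_mem hw _
  have hsum : (f.sum fun _ a => a) = 1 := by
    rw [Finsupp.sum, hsupp, Finset.sum_congr rfl hf, Finset.sum_const, nsmul_eq_mul,
      mul_one_div_cancel hcard]
  have hnonneg : ∀ w, 0 ≤ f w := by
    intro w
    by_cases h : w ∈ s
    · rw [hf w h]; positivity
    · rw [← hsupp, Finsupp.notMem_support_iff] at h
      exact h.ge
  refine ⟨⟨f, hsupp.symm ▸ hs, hnonneg, hsum⟩, hsupp, fun w hw => ?_⟩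
  change f w = 1 / f.support.card
  rw [hsupp]
  exact hf w (hsupp ▸ hw)

theorem IsBarycenter.ext {x y : Realization K} (hx : IsBarycenter x) (hy : IsBarycenter y)
    (h : x.1.support = y.1.support) : x = y := by
  refine Subtype.ext (Finsupp.ext fun w => ?_)
  by_cases hw : w ∈ x.1.support
  · rw [hx w hw, hy w (h ▸ hw), h]
  · rw [Finsupp.notMem_support_iff.1 hw, Finsupp.notMem_support_iff.1 (h ▸ hw)]

theorem closedSimplex_isInducing (s : Finset W) :
    Topology.IsInducing (fun (x : ClosedSimplex K s) (w : W) => x.1.1 w) := ⟨rfl⟩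

theorem closedSimplex_injective (s : Finset W) :
    Function.Injective (fun (x : ClosedSimplex K s) (w : W) => x.1.1 w) := fun _ _ h =>
  Subtype.ext (Subtype.ext (DFunLike.coe_injective h))

instance (s : Finset W) : T2Space (ClosedSimplex K s) :=
  (Topology.IsEmbedding.mk (closedSimplex_isInducing s) (closedSimplex_injective s)).t2Space

theorem isClosed_of_forall_isBarycenter {S : Set (Realization K)} (hS : ∀ x ∈ S, IsBarycenter x) :
    IsClosed S := by
  refine isClosed_iSup_iff.2 fun s => isClosed_iSup_iff.2 fun _ => isClosed_coinduced.2 ?_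
  refine Set.Finite.isClosed (Set.Finite.of_finite_image (f := fun x : ClosedSimplex K s =>
    x.1.1.support) (s.powerset.finite_toSet.subset ?_) ?_)
  · rintro _ ⟨x, -, rfl⟩
    exact Finset.mem_coe.2 (Finset.mem_powerset.2 x.2)
  · intro x hx y hy h
    exact Subtype.ext ((hS _ hx).ext (hS _ hy) h)

theorem hasFinitelyManyOrbits_of_compactSpace [CompactSpace (Quot (SameOrbit K ρ))] :
    HasFinitelyManyOrbits K ρ := by
  choose b hbs hb using fun s : K.faces => exists_isBarycenter s.2
  let q : K.faces → Quot (SameOrbit K ρ) := fun s => Quot.mk _ (b s)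
  let B : Quot (SameOrbit K ρ) → Prop := Quot.lift IsBarycenter fun _ _ h =>
    propext h.isBarycenter_iff
  have hclosed : ∀ A ⊆ Set.range q, IsClosed A := by
    intro A hA
    rw [← isQuotientMap_quot_mk.isClosed_preimage]
    refine isClosed_of_forall_isBarycenter fun x hx => ?_
    obtain ⟨s, hs⟩ := hA hx
    have : B (Quot.mk _ x) := hs ▸ hb s
    exact this
  have hfin : (Set.range q).Finite := by
    refine (hclosed _ subset_rfl).isCompact.finite ⟨discreteTopology_iff_forall_isClosed.2 fun t => ?_⟩
    have := (hclosed (Subtype.val '' t) (by rintro _ ⟨x, -, rfl⟩; exact x.2)).preimage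
      (continuous_subtype_val (p := (· ∈ Set.range q)))
    rwa [Set.preimage_image_eq _ Subtype.val_injective] at this
  have := hfin.to_subtype
  choose r hr using fun y : Set.range q => y.2
  refine ⟨Set.range fun y => (r y).1, Set.finite_range _, ?_, fun s hs => ?_⟩
  · rintro _ ⟨y, rfl⟩
    exact (r y).2
  · set t := r ⟨q ⟨s, hs⟩, _, rfl⟩ with ht
    have hts : q t = q ⟨s, hs⟩ := hr _
    refine ⟨t, ⟨_, rfl⟩, ?_⟩
    let R : Quot (SameOrbit K ρ) → Prop := Quot.lift (fun x => ∃ γ : Γ,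
      t.1.map (ρ γ : Equiv.Perm W).toEmbedding = x.1.support) fun _ _ h =>
        propext (h.exists_map_iff t.1)
    have h1 : R (q t) := by
      refine ⟨1, ?_⟩
      rw [hbs]
      ext w; simp; rfl
    rw [hts] at h1
    obtain ⟨γ, hγ⟩ := h1
    exact ⟨γ, hγ.trans (hbs _)⟩

theorem compactSpace_closedSimplex {s : Finset W} (hs : s ∈ K.faces) :
    CompactSpace (ClosedSimplex K s) := by
  refine ⟨(closedSimplex_isInducing s).isCompact_iff.2 ?_⟩
  have himage : (fun (x : ClosedSimplex K s) (w : W) => x.1.1 w) '' Set.univ =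
      (Set.univ.pi fun _ : W => Set.Icc (0 : ℝ) 1) ∩
        {f | (∀ w ∉ s, f w = 0) ∧ ∑ w ∈ s, f w = 1} := by
    ext f
    constructor
    · rintro ⟨x, -, rfl⟩
      have hsum : ∑ w ∈ s, x.1.1 w = 1 :=
        (Finsupp.sum_of_support_subset _ x.2 _ fun _ _ => rfl).symm.trans x.1.2.2.2
      have hz : ∀ w ∉ s, x.1.1 w = 0 := fun w hw =>
        Finsupp.notMem_support_iff.1 fun h => hw (x.2 h)
      refine ⟨fun w _ => ⟨x.1.2.2.1 w, ?_⟩, hz, hsum⟩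
      by_cases hw : w ∈ s
      · exact (Finset.single_le_sum (fun u _ => x.1.2.2.1 u) hw).trans_eq hsum
      · simp only [hz w hw]
        exact zero_le_one
    · rintro ⟨h1, h2, h3⟩
      let g : W →₀ ℝ := Finsupp.onFinset s f fun w hw => by
        by_contra h
        exact hw (h2 w h)
      have hg : g.support ⊆ s := Finsupp.support_onFinset_subset
      have hsum : (g.sum fun _ x => x) = 1 :=
        (Finsupp.sum_of_support_subset _ hg _ fun _ _ => rfl).trans h3
      have hne : g.support.Nonempty := by
        rw [Finset.nonempty_iff_ne_empty]
        intro h0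
        rw [Finsupp.sum, h0, Finset.sum_empty] at hsum
        exact zero_ne_one hsum
      exact ⟨⟨⟨g, mem_faces_of_subset hs hg hne, fun w => (h1 w trivial).1, hsum⟩, hg⟩, trivial, rfl⟩
  rw [himage]
  refine (isCompact_univ_pi fun _ => isCompact_Icc).inter_right ?_
  simp only [Set.ofPred_and, Set.ofPred_forall]
  exact (isClosed_iInter fun w => isClosed_iInter fun _ =>
    isClosed_eq (continuous_apply w) continuous_const).inter
    (isClosed_eq (continuous_finsetSum _ fun w _ => continuous_apply w) continuous_const)

theorem continuous_closedSimplex_val {s : Finset W} (hs : s ∈ K.faces) :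
    Continuous (fun x : ClosedSimplex K s => x.1) :=
  continuous_iff_coinduced_le.2 (le_iSup₂_of_le s hs le_rfl)

theorem compactSpace_of_hasFinitelyManyOrbits (h : HasFinitelyManyOrbits K ρ) :
    CompactSpace (Quot (SameOrbit K ρ)) := by
  obtain ⟨F, hF, hFK, hcover⟩ := h
  have huniv : (Set.univ : Set (Quot (SameOrbit K ρ))) =
      ⋃ t ∈ F, Set.range fun x : ClosedSimplex K t => Quot.mk _ x.1 := by
    refine (Set.eq_univ_of_forall fun z => ?_).symm
    obtain ⟨x, rfl⟩ := Quot.exists_rep z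
    obtain ⟨t, ht, γ, hγ⟩ := hcover _ x.2.1
    let y := Finsupp.equivMapDomain (ρ γ : Equiv.Perm W).symm x.1
    have hy : y.support = t := by
      change x.1.support.map _ = t
      rw [← hγ, Finset.map_map]
      ext w; simp
    have hsum : (y.sum fun _ a => a) = 1 := (Finsupp.sum_equivMapDomain _ _ _).trans x.2.2.2
    let y' : Realization K := ⟨y, hy ▸ hFK ht, fun w => x.2.2.1 _, hsum⟩
    refine Set.mem_iUnion₂.2 ⟨t, ht, ⟨y', hy.subset⟩, Quot.sound ⟨γ, fun v => ?_⟩⟩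
    rfl
  refine ⟨huniv ▸ hF.isCompact_biUnion fun t ht => ?_⟩
  have := compactSpace_closedSimplex (hFK ht)
  exact isCompact_range (continuous_quot_mk.comp (continuous_closedSimplex_val (hFK ht)))

end Cocompact

/-! ### The action on the subdivision -/

section Transporter

variable {W Γ : Type*} [Group Γ] {K : PreAbstractSimplicialComplex W} {ρ : Γ →* Aut K}

theorem finite_transporter {u : W}
    (h : {γ : Γ | ({u} : Finset W).map (ρ γ : Equiv.Perm W).toEmbedding = {u}}.Finite) (w : W) :
    {γ : Γ | (ρ γ : Equiv.Perm W) u = w}.Finite := by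
  rcases Set.eq_empty_or_nonempty {γ : Γ | (ρ γ : Equiv.Perm W) u = w} with h0 | ⟨δ, hδ⟩
  · rw [h0]; exact Set.finite_empty
  · refine (h.image (δ * ·)).subset fun γ hγ => ⟨δ⁻¹ * γ, ?_, by simp⟩
    have hγ' : (ρ γ : Equiv.Perm W) u = (ρ δ : Equiv.Perm W) u := Eq.trans hγ (Eq.symm hδ)
    simp [hγ']

theorem finite_star (ht : ∀ u w : W, {γ : Γ | (ρ γ : Equiv.Perm W) u = w}.Finite)
    (ho : HasFinitelyManyOrbits K ρ) (v : W) : {w | ∃ s ∈ K.faces, v ∈ s ∧ w ∈ s}.Finite := by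
  obtain ⟨F, hF, -, hF'⟩ := ho
  have : (⋃ t ∈ F, ⋃ a ∈ (t : Set W), ⋃ b ∈ (t : Set W),
      (fun γ : Γ => (ρ γ : Equiv.Perm W) b) '' {γ : Γ | (ρ γ : Equiv.Perm W) a = v}).Finite :=
    hF.biUnion fun t _ => t.finite_toSet.biUnion fun a _ => t.finite_toSet.biUnion fun b _ =>
      (ht a v).image _
  refine this.subset ?_
  rintro w ⟨s, hs, hv, hw⟩
  obtain ⟨t, htF, γ, rfl⟩ := hF' s hs
  obtain ⟨a, ha, hav⟩ := Finset.mem_map.1 hv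
  obtain ⟨b, hb, hbw⟩ := Finset.mem_map.1 hw
  simp only [Set.mem_iUnion]
  exact ⟨t, htF, a, ha, b, hb, γ, hav, hbw⟩

end Transporter

section Extension

variable {V : Type*} {G : SimpleGraph V}

theorem pair_mem_oneSkeleton [DecidableEq V] {u v : V} (h : u ≠ v) :
    ({u, v} : Finset V) ∈ (oneSkeleton G).faces ↔ G.Adj u v := by
  constructor
  · rintro ⟨-, B, ⟨x, rfl⟩ | ⟨x, y, hxy, rfl⟩, hB⟩
    · have hu := @hB u (by simp)
      have hv := @hB v (by simp)
      exact absurd (Eq.trans hu (Eq.symm hv)) h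
    · have hu := @hB u (by simp)
      have hv := @hB v (by simp)
      rcases hu with rfl | rfl <;> rcases hv with rfl | rfl
      · exact absurd rfl h
      · exact hxy
      · exact hxy.symm
      · exact absurd rfl h
  · intro h
    exact ⟨Finset.insert_nonempty _ _, _, Or.inr ⟨u, v, h, rfl⟩, by simp⟩

/-- An automorphism of the `1`-skeleton is an automorphism of the graph. -/
def graphIso (g : Aut (oneSkeleton G)) : G ≃g G where
  toEquiv := g.1
  map_rel_iff' := by
    classical
    intro u v
    rcases eq_or_ne u v with rfl | h
    · simp
    · rw [← pair_mem_oneSkeleton h, ← pair_mem_oneSkeleton (g.1.injective.ne h), ← g.2 {u, v}]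
      simp

/-- The image of a pentagon. -/
def Pentagon.map (e : G ≃g G) (P : Pentagon G) : Pentagon G :=
  ⟨e '' P.1, by
    obtain ⟨φ, hφ⟩ := P.2
    refine ⟨φ.trans e.toRelEmbedding, ?_⟩
    rw [← hφ, ← Set.range_comp]
    rfl⟩

/-- The vertex permutation of the subdivision induced by an automorphism of the graph. -/
def subdivisionPerm (e : G ≃g G) : Equiv.Perm (V ⊕ Pentagon G) :=
  Equiv.sumCongr e.toEquiv
    { toFun := Pentagon.map e
      invFun := Pentagon.map e.symm
      left_inv := fun P => Subtype.ext (by simp [Pentagon.map, Set.image_image])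
      right_inv := fun P => Subtype.ext (by simp [Pentagon.map, Set.image_image]) }

theorem subdivisionPerm_inl (e : G ≃g G) (v : V) :
    subdivisionPerm e (Sum.inl v) = Sum.inl (e v) := rfl

theorem subdivisionPerm_inr (e : G ≃g G) (P : Pentagon G) :
    subdivisionPerm e (Sum.inr P) = Sum.inr (P.map e) := rfl

theorem map_subdivisionPerm_mem_faces (e : G ≃g G) {s : Finset (V ⊕ Pentagon G)}
    (hs : s ∈ (subdivision G).faces) :
    s.map (subdivisionPerm e).toEmbedding ∈ (subdivision G).faces := by
  obtain ⟨hne, B, hB, hsB⟩ := hs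
  refine ⟨hne.map, subdivisionPerm e '' B, ?_, by
    rw [Finset.coe_map]; exact Set.image_mono hsB⟩
  rcases hB with ((⟨v, rfl⟩ | ⟨u, v, h, rfl⟩) | ⟨u, v, w, h, h', h'', rfl⟩) |
    ⟨P, u, v, hu, hv, h, rfl⟩
  · exact Or.inl (Or.inl (Or.inl ⟨e v, by simp [subdivisionPerm_inl]⟩))
  · exact Or.inl (Or.inl (Or.inr ⟨e u, e v, e.map_adj_iff.2 h, by
      simp [Set.image_insert_eq, subdivisionPerm_inl]⟩))
  · exact Or.inl (Or.inr ⟨e u, e v, e w, e.map_adj_iff.2 h, e.map_adj_iff.2 h',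
      e.map_adj_iff.2 h'', by simp [Set.image_insert_eq, subdivisionPerm_inl]⟩)
  · exact Or.inr ⟨P.map e, e u, e v, ⟨u, hu, rfl⟩, ⟨v, hv, rfl⟩, e.map_adj_iff.2 h, by
      simp [Set.image_insert_eq, subdivisionPerm_inl, subdivisionPerm_inr]⟩

theorem subdivisionPerm_mem_aut (e : G ≃g G) : subdivisionPerm e ∈ Aut (subdivision G) := by
  intro s
  refine ⟨fun h => ?_, map_subdivisionPerm_mem_faces e⟩
  have := map_subdivisionPerm_mem_faces e.symm h
  rw [Finset.map_map] at this
  convert this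
  refine (Finset.map_refl (s := s)).symm.trans ?_
  congr 1
  ext1 w
  exact ((subdivisionPerm e).symm_apply_apply w).symm

variable (G) in
/-- The automorphisms of the `1`-skeleton act on the subdivision. -/
def extendAut : Aut (oneSkeleton G) →* Aut (subdivision G) where
  toFun g := ⟨subdivisionPerm (graphIso g), subdivisionPerm_mem_aut _⟩
  map_one' := by
    refine Subtype.ext (Equiv.ext ?_)
    rintro (v | P)
    · rfl
    · exact congrArg Sum.inr (Subtype.ext (Set.image_id _))
  map_mul' g h := by
    refine Subtype.ext (Equiv.ext ?_)
    rintro (v | P)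
    · rfl
    · exact congrArg Sum.inr (Subtype.ext (Set.image_comp g.1 h.1 _))

/-- The closed star of a vertex of the graph in the subdivision. -/
def closedStar (G : SimpleGraph V) (v : V) : Set (V ⊕ Pentagon G) :=
  Sum.inl '' insert v (G.neighborSet v) ∪ Sum.inr '' {P | v ∈ P.1}

theorem exists_subset_closedStar {s : Finset (V ⊕ Pentagon G)} (hs : s ∈ (subdivision G).faces) :
    ∃ v, (s : Set (V ⊕ Pentagon G)) ⊆ closedStar G v := by
  obtain ⟨-, B, hB, hsB⟩ := hs
  rcases hB with ((⟨v, rfl⟩ | ⟨v, w, h, rfl⟩) | ⟨v, u, w, h, h', h'', rfl⟩) |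
    ⟨P, v, w, hu, hv, h, rfl⟩ <;>
  refine ⟨v, hsB.trans ?_⟩ <;>
  simp_all [closedStar, Set.insert_subset_iff]

theorem extendAut_mem_closedStar (g : Aut (oneSkeleton G)) {v : V} {x : V ⊕ Pentagon G}
    (hx : x ∈ closedStar G v) :
    (extendAut G g : Equiv.Perm (V ⊕ Pentagon G)) x ∈ closedStar G (g.1 v) := by
  rcases hx with ⟨w, rfl | hw, rfl⟩ | ⟨P, hP, rfl⟩
  · exact Or.inl ⟨_, Or.inl rfl, rfl⟩
  · exact Or.inl ⟨_, Or.inr ((graphIso g).map_adj_iff.2 hw), rfl⟩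
  · exact Or.inr ⟨P.map (graphIso g), ⟨v, hP, rfl⟩, rfl⟩

theorem cycleGraph_five_diameter : ∀ i j : Fin 5, ∃ k,
    (k = i ∨ (SimpleGraph.cycleGraph 5).Adj i k) ∧
      (j = k ∨ (SimpleGraph.cycleGraph 5).Adj k j) := by
  simp only [SimpleGraph.cycleGraph_adj]
  decide

theorem finite_closedStar (h : ∀ v, (G.neighborSet v).Finite) (v : V) :
    (closedStar G v).Finite := by
  refine Set.Finite.union (((h v).insert v).image _) (Set.Finite.image _ ?_)
  have hball : (⋃ u ∈ insert v (G.neighborSet v), insert u (G.neighborSet u)).Finite :=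
    ((h v).insert v).biUnion fun u _ => (h u).insert u
  refine Set.Finite.of_finite_image (f := Subtype.val)
    (hball.finite_subsets.subset ?_) Subtype.val_injective.injOn
  rintro _ ⟨P, hP, rfl⟩ w hw
  obtain ⟨φ, hφ⟩ := P.2
  change v ∈ P.1 at hP
  rw [← hφ] at hP hw
  obtain ⟨i, rfl⟩ := hP
  obtain ⟨j, rfl⟩ := hw
  obtain ⟨k, hk, hj⟩ := cycleGraph_five_diameter i j
  simp only [Set.mem_iUnion]
  exact ⟨φ k, hk.imp (congrArg φ) φ.map_adj_iff.2, hj.imp (congrArg φ) φ.map_adj_iff.2⟩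

theorem Pentagon.finite (P : Pentagon G) : P.1.Finite := by
  obtain ⟨φ, hφ⟩ := P.2
  rw [← hφ]
  exact Set.finite_range _

variable {Γ : Type*} [Group Γ] {ρ : Γ →* Aut (oneSkeleton G)}

theorem singleton_mem_oneSkeleton (v : V) : {v} ∈ (oneSkeleton G).faces :=
  ⟨Finset.singleton_nonempty _, _, Or.inl ⟨v, rfl⟩, by simp⟩

theorem hasFinitelyManyOrbits_extendAut
    (ht : ∀ u w : V, {γ : Γ | (ρ γ : Equiv.Perm V) u = w}.Finite)
    (ho : HasFinitelyManyOrbits (oneSkeleton G) ρ) :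
    HasFinitelyManyOrbits (subdivision G) ((extendAut G).comp ρ) := by
  classical
  have hN : ∀ v, (G.neighborSet v).Finite := fun v => (finite_star ht ho v).subset fun w hw =>
    ⟨{v, w}, (pair_mem_oneSkeleton (G.ne_of_adj hw)).2 hw, by simp, by simp⟩
  obtain ⟨F, hF, -, hF'⟩ := ho
  refine ⟨(⋃ t ∈ F, ⋃ v ∈ (t : Set V), {s | (s : Set (V ⊕ Pentagon G)) ⊆ closedStar G v}) ∩
    (subdivision G).faces, Set.Finite.inter_of_left (hF.biUnion fun t _ =>
      t.finite_toSet.biUnion fun v _ => ?_) _, Set.inter_subset_right, fun s hs => ?_⟩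
  · exact (finite_closedStar hN v).finite_subsets.preimage Finset.coe_injective.injOn
  · obtain ⟨v, hv⟩ := exists_subset_closedStar hs
    obtain ⟨t, htF, γ, hγ⟩ := hF' {v} (singleton_mem_oneSkeleton v)
    have hvt : v ∈ t.map (ρ γ : Equiv.Perm V).toEmbedding := by rw [hγ]; simp
    obtain ⟨u, hu, huv⟩ := Finset.mem_map.1 hvt
    have huv' : (ρ γ⁻¹ : Equiv.Perm V) v = u := by
      rw [← huv]; simp
    refine ⟨s.map (extendAut G (ρ γ⁻¹) : Equiv.Perm (V ⊕ Pentagon G)).toEmbedding,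
      ⟨?_, ((extendAut G (ρ γ⁻¹)).2 s).2 hs⟩, γ, ?_⟩
    · simp only [Set.mem_iUnion]
      refine ⟨t, htF, u, hu, ?_⟩
      rw [Set.mem_ofPred_eq, Finset.coe_map]
      rintro _ ⟨x, hx, rfl⟩
      rw [← huv']
      exact extendAut_mem_closedStar _ (hv hx)
    · rw [Finset.map_map]
      ext w
      simp

theorem finite_stabilizer_extendAut
    (ht : ∀ u w : V, {γ : Γ | (ρ γ : Equiv.Perm V) u = w}.Finite)
    {s : Finset (V ⊕ Pentagon G)} (hs : s ∈ (subdivision G).faces) :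
    {γ : Γ | s.map ((extendAut G).comp ρ γ : Equiv.Perm (V ⊕ Pentagon G)).toEmbedding = s}.Finite := by
  obtain ⟨x, hx⟩ := hs.1
  have hmem : ∀ γ : Γ,
      s.map ((extendAut G).comp ρ γ : Equiv.Perm (V ⊕ Pentagon G)).toEmbedding = s →
        (extendAut G (ρ γ) : Equiv.Perm (V ⊕ Pentagon G)) x ∈ s := fun γ hγ => by
    have := Finset.mem_map_of_mem
      ((extendAut G).comp ρ γ : Equiv.Perm (V ⊕ Pentagon G)).toEmbedding hx
    rwa [hγ] at this
  rcases x with u | P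
  · refine ((s.finite_toSet.preimage Sum.inl_injective.injOn).biUnion fun w _ => ht u w).subset
      fun γ hγ => ?_
    exact Set.mem_biUnion (hmem γ hγ : _ ∈ Sum.inl ⁻¹' (s : Set (V ⊕ Pentagon G))) rfl
  · obtain ⟨u, hu⟩ := P.nonempty
    refine (P.finite.biUnion fun w _ => ht u w).subset fun γ hγ => ?_
    have hP : P = P.map (graphIso (ρ γ)) := eq_of_mem_face hs hx (hmem γ hγ)
    refine Set.mem_biUnion (x := (ρ γ : Equiv.Perm V) u) ?_ rfl
    rw [hP]
    exact ⟨u, hu, rfl⟩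

theorem isGeometricAction_extendAut (hρ : IsGeometricAction (oneSkeleton G) ρ) :
    IsGeometricAction (subdivision G) ((extendAut G).comp ρ) := by
  have ht : ∀ u w : V, {γ : Γ | (ρ γ : Equiv.Perm V) u = w}.Finite := fun u =>
    finite_transporter (hρ.1 _ (singleton_mem_oneSkeleton u))
  have := hρ.2
  exact ⟨fun s hs => finite_stabilizer_extendAut ht hs, compactSpace_of_hasFinitelyManyOrbits
    (hasFinitelyManyOrbits_extendAut ht hasFinitelyManyOrbits_of_compactSpace)⟩

end Extension

end TrianglePentagon

end

theorem corollary3p4 {V Γ : Type*} [Group Γ] (G : SimpleGraph V)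
    (hG : IsEmpty (SimpleGraph.cycleGraph 4 ↪g G))
    (hX : TrianglePentagon.IsCAT0 (TrianglePentagon.Space G))
    (ρ : Γ →* TrianglePentagon.Aut (TrianglePentagon.oneSkeleton G))
    (hρ : TrianglePentagon.IsGeometricAction (TrianglePentagon.oneSkeleton G) ρ) :
    (∃ ρs : Γ →* TrianglePentagon.Aut (TrianglePentagon.subdivision G),
      (∀ (γ : Γ) (v : V),
        (ρs γ : Equiv.Perm (V ⊕ TrianglePentagon.Pentagon G)) (Sum.inl v) =
          Sum.inl ((ρ γ : Equiv.Perm V) v)) ∧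
      (∀ (γ : Γ) (P : TrianglePentagon.Pentagon G), ∃ Q : TrianglePentagon.Pentagon G,
        Q.1 = (ρ γ : Equiv.Perm V) '' P.1 ∧
          (ρs γ : Equiv.Perm (V ⊕ TrianglePentagon.Pentagon G)) (Sum.inr P) = Sum.inr Q) ∧
      TrianglePentagon.IsGeometricAction (TrianglePentagon.subdivision G) ρs) ∧
    TrianglePentagon.IsLocated 7 (TrianglePentagon.subdivision G) ∧
    TrianglePentagon.IsLocallyLarge 5 (TrianglePentagon.subdivision G) :=
  ⟨⟨(TrianglePentagon.extendAut G).comp ρ, fun _ _ => rfl, fun γ P =>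
    ⟨P.map (TrianglePentagon.graphIso (ρ γ)), rfl, rfl⟩,
    TrianglePentagon.isGeometricAction_extendAut hρ⟩,
    TrianglePentagon.isLocated_subdivision hX, TrianglePentagon.isLocallyLarge_subdivision hX⟩
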